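/- **Setting.** Let $G=(\mathcal X,\mathcal E)$ be a finite non-oriented graph (loops allowed), let $\vec{\mathcal E}=\{(i,j):\{i,j\}\in\mathcal E\}$ be its set of oriented edges, and let $R$ be a finite set with $d=|R|$ elements. Let $\mathcal M$ be the set of Markov matrices on $\vec{\mathcal E}$ and $\Delta_R$ the set of probability measures on $R$, viewed in the Euclidean space $\mathbb R^R$. A Markov matrix $M$ on $\vec{\mathcal E}$ is *indecomposable* if there is a non-empty set $C\subset\vec{\mathcal E}$ such that every $j\in C$ can be reached from every $i\in\vec{\mathcal E}$ by a path of transitions with positive probability under $M$. Such an $M$ has a unique invariant probability measure $\pi$, and $I-M$ has a unique pseudo-inverse $Q$, characterized by $Q\mathbf 1=0$ and $Q(I-M)=(I-M)Q=I-\Pi$, where every row of $\Pi$ equals $\pi$. For $\Sigma\subset\Delta_R$ convex, $\mathring\Sigma$ denotes the interior of $\Sigma$ relative to its affine hull (this is the interior relative to the hyperplane of measures of total mass $1$ whenever the latter interior is non-empty). Let $(\Omega,\mathcal F,\mathbb P)$ be a probability space with a filtration $(\mathcal F_n)_{n\ge0}$, and let $((X_n,P_n,V_n))_{n\ge0}$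 be an $(\mathcal F_n)$-adapted process with values in $\mathcal X\times\mathcal M\times\Delta_R$ such that, for all $n\ge1$, $E_n:=(X_{n-1},X_n)\in\vec{\mathcal E}$ and $$\mathbb P(E_{n+1}=e\mid\mathcal F_n)=P_n(E_n,e)\quad\text{a.s., for all } e\in\vec{\mathcal E}.$$ For $n\ge0$ put $v_n=\frac1{n+d}\bigl(1+\sum_{k=1}^nV_k\bigr)\in\Delta_R$, where $1$ is the constant function on $R$. **Hypotheses.** 1. There are a transition matrix $V$ from $\vec{\mathcal E}$ to $R$ (each $V(e)$, $e\in\vec{\mathcal E}$, is a probability measure on $R$), a compact convex set $\Sigma\subset\Delta_R$ and a continuous map $P:\Sigma\to\mathcal M$ such that, almost surely, for all $n\ge1$: $V_n=V(E_n)$, $v_n\in\mathring\Sigma$ and $P_n=P(v_n)$. 2. $P:\Sigma\to\mathcal M$ is Lipschitz, and $P(v)$ is indecomposable for all $v\in\mathring\Sigma$. 3. For $v\in\mathring\Sigma$ let $\pi(v)$ be the invariant probability measure of $P(v)$, $\pi^V(v)=\pi(v)V\in\Delta_R$, and $Q(v)$ the pseudo-inverse of $I-P(v)$. The map $\pi^V:\mathring\Sigma\to\Delta_R$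 has a Lipschitz extension $\pi^V:\Sigma\to\Delta_R$, and for every $e\in\vec{\mathcal E}$ the map $v\mapsto Q(v)V(e)$ has a continuous extension from $\mathring\Sigma$ to $\Sigma$. Let $T_1=\{v\in\mathbb R^R:\sum_rv(r)=1\}$, for $v\in T_1$ let $\mu(v)$ be the point of $\Sigma$ closest to $v$ in Euclidean distance, and let $F(v)=-v+\pi^V(\mu(v))$. **Theorem.** Under Hypotheses 1–3, $F$ induces a unique global flow $\Phi:\mathbb R\times T_1\to T_1$, $\partial_t\Phi_t(v)=F(\Phi_t(v))$, $\Phi_0(v)=v$, and, almost surely, the limit set $L$ of $(v_n)$ (the set of all limits $\lim_k v_{n_k}$ with $n_k\to\infty$) is contained in $\Sigma$ and is attractor free for $\Phi$. That is: $L$ is closed and invariant ($\Phi_t(v)\in L$ for all $v\in L$, $t\in\mathbb R$), and no subset $B\ne L$ of $L$ is an attractor of the flow restricted to $L$. Here $B\subset L$ is an attractor of the restricted flow if it is non-empty, compact and invariant and there are a neighbourhood $U$ of $B$ in $L$, an $\varepsilon_0>0$ and a function $\mathbf t:(0,\varepsilon_0)\to\mathbb R_+$ such that for all $\varepsilon\in(0,\varepsilon_0)$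 and all $t\ge\mathbf t(\varepsilon)$, $\Phi_t(U)$ is contained in the $\varepsilon$-neighbourhood of $B$. -/

import Mathlib

open MeasureTheory Filter Topology

noncomputable section

/-! ### Markov matrices, invariant measures and pseudo-inverses -/

/-- `T : A × B → ℝ` is a transition matrix from `A` to `B`: each row is a probability measure. -/
def IsTransitionMatrix {A B : Type*} [Fintype B] (T : Matrix A B ℝ) : Prop :=
  ∀ a, (∀ b, 0 ≤ T a b) ∧ ∑ b, T a b = 1

/-- `P` is indecomposable: there is a non-empty set (a recurrent class) each point of which can be
reached from every point through a path of transitions of positive probability. -/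
def IsIndecomposable {A : Type*} (P : Matrix A A ℝ) : Prop :=
  ∃ C : Set A, C.Nonempty ∧ ∀ i, ∀ j ∈ C, Relation.TransGen (fun a b => 0 < P a b) i j

/-- `p` is an invariant probability measure of `P`. -/
def IsInvariantProb {A : Type*} [Fintype A] (P : Matrix A A ℝ) (p : A → ℝ) : Prop :=
  p ∈ stdSimplex ℝ A ∧ Matrix.vecMul p P = p

/-- The invariant probability measure of `P`; it exists and is unique when `P` is an indecomposable
Markov matrix. -/
def invariantProb {A : Type*} [Fintype A] (P : Matrix A A ℝ) : A → ℝ :=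
  Classical.epsilon (IsInvariantProb P)

/-- `Q` is the pseudo-inverse of `I - P`: `Q 1 = 0` and `Q (I - P) = (I - P) Q = I - Π`, where every
row of `Π` is the invariant probability measure of `P`. -/
def IsPseudoInverse {A : Type*} [Fintype A] [DecidableEq A] (P Q : Matrix A A ℝ) : Prop :=
  Q.mulVec (fun _ => 1) = 0 ∧
  Q * (1 - P) = 1 - Matrix.of (fun _ j => invariantProb P j) ∧
  (1 - P) * Q = 1 - Matrix.of (fun _ j => invariantProb P j)

/-- The pseudo-inverse of `I - P`; it exists and is unique when `P` is an indecomposable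
Markov matrix. -/
def pseudoInverse {A : Type*} [Fintype A] [DecidableEq A] (P : Matrix A A ℝ) : Matrix A A ℝ :=
  Classical.epsilon (IsPseudoInverse P)

/-! ### Measures on the reinforcement set, as points of a Euclidean space -/

/-- The set of probability measures on the finite set `R`. -/
def probMeasures (R : Type*) [Fintype R] : Set (EuclideanSpace ℝ R) :=
  {v | (∀ r, 0 ≤ v r) ∧ ∑ r, v r = 1}

/-- The affine hyperplane of signed measures on `R` of total mass one. -/
def massOne (R : Type*) [Fintype R] : Set (EuclideanSpace ℝ R) :=
  {v | ∑ r, v r = 1}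

/-- The point of `S` closest to `v`; it exists and is unique when `S` is non-empty, compact
and convex. -/
def nearestPoint {R : Type*} [Fintype R] (S : Set (EuclideanSpace ℝ R))
    (v : EuclideanSpace ℝ R) : EuclideanSpace ℝ R :=
  Classical.epsilon fun w => w ∈ S ∧ ∀ u ∈ S, dist v w ≤ dist v u

/-- The measure `π V` on `R`, where `π` is the invariant probability measure of `P`. -/
def piV {A R : Type*} [Fintype A] [Fintype R] (V : Matrix A R ℝ) (P : Matrix A A ℝ) :
    EuclideanSpace ℝ R :=
  WithLp.toLp 2 (Matrix.vecMul (invariantProb P) V)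

/-- The vector field `F(v) = -v + g(μ(v))`, where `μ(v)` is the point of `S` closest to `v`. -/
def reinforcementField {R : Type*} [Fintype R] (S : Set (EuclideanSpace ℝ R))
    (g : EuclideanSpace ℝ R → EuclideanSpace ℝ R) (v : EuclideanSpace ℝ R) :
    EuclideanSpace ℝ R :=
  -v + g (nearestPoint S v)

/-! ### Flows, attractors, limit sets -/

/-- `Φ` is a global flow on `M` solving `∂ₜ Φₜ(v) = F(Φₜ(v))`, `Φ₀(v) = v`. -/
def IsFlowOn {H : Type*} [NormedAddCommGroup H] [NormedSpace ℝ H] (M : Set H) (F : H → H)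
    (Φ : ℝ → H → H) : Prop :=
  ∀ v ∈ M, Φ 0 v = v ∧ ∀ t, Φ t v ∈ M ∧ HasDerivAt (fun s => Φ s v) (F (Φ t v)) t

/-- `A` is invariant: orbits (over all of `ℝ`) of points of `A` stay in `A`. -/
def IsInvariantSet {H : Type*} (Φ : ℝ → H → H) (A : Set H) : Prop :=
  ∀ v ∈ A, ∀ t, Φ t v ∈ A

/-- The subset `B` of `A` is an attractor of the flow `Φ` restricted to the set `A`: it is non-empty,
compact and invariant, and it attracts, uniformly, a neighbourhood `U ∩ A` of itself in `A`. -/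
def IsAttractorIn {H : Type*} [PseudoMetricSpace H] (Φ : ℝ → H → H) (A B : Set H) : Prop :=
  B ⊆ A ∧ B.Nonempty ∧ IsCompact B ∧ IsInvariantSet Φ B ∧
  ∃ U ∈ 𝓝ˢ B, ∃ ε₀ > 0, ∃ τ : ℝ → ℝ, ∀ ε, 0 < ε → ε < ε₀ → 0 ≤ τ ε ∧
    ∀ t, τ ε ≤ t → ∀ v ∈ U ∩ A, Φ t v ∈ Metric.thickening ε B

/-- `A` is closed, invariant, and the flow restricted to `A` has no attractor other than `A`. -/
def IsAttractorFree {H : Type*} [PseudoMetricSpace H] (Φ : ℝ → H → H) (A : Set H) : Prop :=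
  IsClosed A ∧ IsInvariantSet Φ A ∧ ¬ ∃ B, B ≠ A ∧ IsAttractorIn Φ A B

/-- The set of all limits of `(x (n_k))` along sequences `n_k → ∞`. -/
def seqLimitSet {H : Type*} [TopologicalSpace H] (x : ℕ → H) : Set H :=
  {y | ∃ n : ℕ → ℕ, Tendsto n atTop atTop ∧ Tendsto (fun k => x (n k)) atTop (𝓝 y)}

/-! ### The reinforced walks -/

/-- The oriented edges of the non-oriented graph with vertex set `𝒳` and edge set `E`
(loops are allowed). -/
def OrientedEdge {𝒳 : Type*} (E : Set (Sym2 𝒳)) : Type _ :=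
  {p : 𝒳 × 𝒳 // s(p.1, p.2) ∈ E}

instance OrientedEdge.instFintype {𝒳 : Type*} [Finite 𝒳] (E : Set (Sym2 𝒳)) : Fintype (OrientedEdge E) :=
  haveI : Finite (OrientedEdge E) := inferInstanceAs (Finite {p : 𝒳 × 𝒳 // s(p.1, p.2) ∈ E})
  Fintype.ofFinite _

instance OrientedEdge.instDecidableEq {𝒳 : Type*} (E : Set (Sym2 𝒳)) : DecidableEq (OrientedEdge E) :=
  Classical.decEq _

/-- The random sequences `((X_n, P_n, V_n))`, adapted to the filtration `ℱ`, with values in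
`𝒳 × {Markov matrices on oriented edges} × {probability measures on R}`, such that
`E_n = (X_{n-1}, X_n)` is an oriented edge and, for `n ≥ 1`, the conditional law of `E_{n+1}`
given `ℱ n` is `P_n(E_n, ·)`. -/
structure EdgeWalk {Ω : Type*} {mΩ : MeasurableSpace Ω} (ℙ : Measure Ω) (ℱ : Filtration ℕ mΩ)
    {𝒳 : Type*} [Finite 𝒳] (E : Set (Sym2 𝒳)) (R : Type*) [Fintype R] where
  /-- the position -/
  X : ℕ → Ω → 𝒳
  /-- the transition matrices -/
  P : ℕ → Ω → Matrix (OrientedEdge E) (OrientedEdge E) ℝ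
  /-- the reinforcements -/
  V : ℕ → Ω → EuclideanSpace ℝ R
  isTransitionMatrix_P : ∀ n ω, IsTransitionMatrix (P n ω)
  V_mem : ∀ n ω, V n ω ∈ probMeasures R
  measurable_X : ∀ n i, MeasurableSet[ℱ n] {ω | X n ω = i}
  measurable_P : ∀ n e e', Measurable[ℱ n] fun ω => P n ω e e'
  measurable_V : ∀ n r, Measurable[ℱ n] fun ω => V n ω r
  mem_edges : ∀ n ω, s(X n ω, X (n + 1) ω) ∈ E
  /-- stated at time `n + 1`, since the pair `(X n, X (n + 1))` is the edge `E_{n+1}` -/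
  condLaw : ∀ (n : ℕ) (e : OrientedEdge E),
    ℙ[Set.indicator {ω | (X (n + 1) ω, X (n + 2) ω) = e.1} (fun _ => (1 : ℝ)) | ℱ (n + 1)]
      =ᵐ[ℙ] fun ω => P (n + 1) ω ⟨(X n ω, X (n + 1) ω), mem_edges n ω⟩ e

namespace EdgeWalk

variable {Ω : Type*} {mΩ : MeasurableSpace Ω} {ℙ : Measure Ω} {ℱ : Filtration ℕ mΩ}
  {𝒳 : Type*} [Finite 𝒳] {E : Set (Sym2 𝒳)} {R : Type*} [Fintype R]

/-- `W.edgeSucc n` is the oriented edge `E_{n+1} = (X_n, X_{n+1})`. -/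
def edgeSucc (W : EdgeWalk ℙ ℱ E R) (n : ℕ) (ω : Ω) : OrientedEdge E :=
  ⟨(W.X n ω, W.X (n + 1) ω), W.mem_edges n ω⟩

/-- The reinforcement probability measure `v_n = (1 + ∑_{k=1}^n V_k) / (n + d)`, `d = |R|`. -/
def reinforcement (W : EdgeWalk ℙ ℱ E R) (n : ℕ) (ω : Ω) : EuclideanSpace ℝ R :=
  ((n : ℝ) + Fintype.card R)⁻¹ •
    (WithLp.toLp 2 (fun _ => (1 : ℝ)) + ∑ k ∈ Finset.Icc 1 n, W.V k ω)

end EdgeWalk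

end

/-!
The measures `vₙ` follow a stochastic approximation scheme: with steps `γₙ` of harmonic type,
`vₙ₊₁ = vₙ + γₙ (F(vₙ) + V(Eₙ₊₁) - π^V(vₙ))`. The proof shows that the noise is negligible, so that
`(vₙ)` shadows the flow of `F` over bounded time windows (`IsAsymptoticTrajectory`), and that the
limit set of a relatively compact sequence with this property is attractor free.

*The flow.* The metric projection on a convex set is `1`-Lipschitz, hence `F(v) = -v + b(v)` with
`b` Lipschitz and bounded on the whole space. The Picard–Lindelöf theorem, applied to `eᵗ v`, gives
a global flow (`exists_isFlowOn_univ_neg_add`). It preserves the total mass one, and it is unique by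
Grönwall's inequality.

*The noise.* The Poisson equation (`poisson_equation`), which rests on the existence of the
pseudo-inverse `Q` for an indecomposable matrix, writes `V(e) - π^V(v)` as `((I - P(v)) Q(v) V)(e)`.
So the noise is the sum of a martingale difference, of an increment of a bounded sequence and of a
term that vanishes by uniform continuity of `v ↦ P(v) Q(v) V`
(`IsFlowOn.isAsymptoticTrajectory_of_markov_noise`). The weighted sums of the first converge almost
surely, because the steps are square summable (`ae_exists_tendsto_sum_of_condExp_eq_zero`), and those
of the second by Abel summation. Subtracting the remainders of these convergent sums leaves a
perturbed Euler scheme, to which a discrete Grönwall argument applies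
(`IsFlowOn.isAsymptoticTrajectory_of_euler`).

*The limit set.* Invariance follows from the transport of limits by the flow, together with
compactness for negative times. An attractor `B ≠ L` of the flow restricted to the limit set `L`
would trap the sequence in a neighbourhood of `B` whose closure does not contain `L`
(`IsAsymptoticTrajectory.isAttractorFree`).
-/

/-! ### Markov matrices: invariant probability measures and the Poisson equation -/

section Markov

variable {A : Type*}

lemma IsTransitionMatrix.mulVec_one {B : Type*} [Fintype B] {T : Matrix A B ℝ}
    (hT : IsTransitionMatrix T) : T.mulVec (fun _ => 1) = fun _ => 1 := by
  funext a
  simpa [Matrix.mulVec, dotProduct] using (hT a).2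

variable [Fintype A]

/-- A Markov matrix has a left fixed vector `x ≠ 0`, since `I - P` is singular. Then `|x| ≤ |x| P`
entrywise and both sides have the same mass, so that `|x|`, normalized, is invariant. -/
theorem exists_isInvariantProb [DecidableEq A] [Nonempty A] {P : Matrix A A ℝ}
    (hP : IsTransitionMatrix P) : ∃ p, IsInvariantProb P p := by
  have hdet : (1 - P).det = 0 := by
    rw [← Matrix.exists_mulVec_eq_zero_iff]
    refine ⟨fun _ => 1, ?_, ?_⟩
    · intro h
      have := congrFun h (Classical.arbitrary A)
      simp at this
    · rw [Matrix.sub_mulVec, hP.mulVec_one, Matrix.one_mulVec, sub_self]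
  obtain ⟨x, hx0, hx⟩ := Matrix.exists_vecMul_eq_zero_iff.2 hdet
  rw [Matrix.vecMul_sub, Matrix.vecMul_one, sub_eq_zero] at hx
  have hxj : ∀ j, x j = ∑ i, x i * P i j := fun j => congrFun hx j
  have hle : ∀ j ∈ Finset.univ, |x j| ≤ ∑ i, |x i| * P i j := by
    intro j _
    rw [hxj j]
    refine (Finset.abs_sum_le_sum_abs _ _).trans (le_of_eq ?_)
    refine Finset.sum_congr rfl fun i _ => ?_
    rw [abs_mul, abs_of_nonneg ((hP i).1 j)]
  have hsum : ∑ j, |x j| = ∑ j, ∑ i, |x i| * P i j := by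
    rw [Finset.sum_comm]
    refine Finset.sum_congr rfl fun i _ => ?_
    rw [← Finset.mul_sum, (hP i).2, mul_one]
  have heq := (Finset.sum_eq_sum_iff_of_le hle).1 hsum
  have hpos : 0 < ∑ j, |x j| := by
    obtain ⟨i, hi⟩ := Function.ne_iff.1 hx0
    exact Finset.sum_pos' (fun j _ => abs_nonneg _) ⟨i, Finset.mem_univ i, abs_pos.2 hi⟩
  refine ⟨fun j => |x j| / ∑ k, |x k|, ⟨fun j => by positivity, ?_⟩, ?_⟩
  · rw [← Finset.sum_div, div_self hpos.ne']
  · funext j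
    simp only [Matrix.vecMul, dotProduct]
    rw [heq j (Finset.mem_univ j), Finset.sum_div]
    exact Finset.sum_congr rfl fun i _ => by ring

/-- The maximum principle: a harmonic function attains its maximum on every recurrent class. -/
lemma IsTransitionMatrix.le_of_harmonic {P : Matrix A A ℝ} (hP : IsTransitionMatrix P)
    {C : Set A} (hC : ∀ i, ∀ j ∈ C, Relation.TransGen (fun a b => 0 < P a b) i j)
    {f : A → ℝ} (hf : P.mulVec f = f) {j : A} (hj : j ∈ C) (i : A) : f i ≤ f j := by
  obtain ⟨m, -, hm⟩ := Finset.exists_max_image Finset.univ f ⟨i, Finset.mem_univ i⟩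
  have hstep : ∀ a b, f a = f m → 0 < P a b → f b = f m := by
    intro a b ha hab
    have h1 : ∑ c, P a c * f c = ∑ c, P a c * f m := by
      rw [← Finset.sum_mul, (hP a).2, one_mul, ← ha]
      exact congrFun hf a
    have h2 := (Finset.sum_eq_sum_iff_of_le fun c _ =>
      mul_le_mul_of_nonneg_left (hm c (Finset.mem_univ c)) ((hP a).1 c)).1 h1 b (Finset.mem_univ b)
    exact mul_left_cancel₀ hab.ne' h2
  have hreach : ∀ b, Relation.TransGen (fun a b => 0 < P a b) m b → f b = f m := by
    intro b hb
    induction hb with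
    | single h => exact hstep _ _ rfl h
    | tail _ h ih => exact hstep _ _ ih h
  rw [hreach j (hC m j hj)]
  exact hm i (Finset.mem_univ i)

lemma IsIndecomposable.harmonic_eq_const {P : Matrix A A ℝ} (hP : IsTransitionMatrix P)
    (hI : IsIndecomposable P) {f : A → ℝ} (hf : P.mulVec f = f) : ∃ c, f = fun _ => c := by
  obtain ⟨C, ⟨j, hj⟩, hC⟩ := hI
  refine ⟨f j, funext fun i => le_antisymm (hP.le_of_harmonic hC hf hj i) ?_⟩
  have hneg : P.mulVec (-f) = -f := by rw [Matrix.mulVec_neg, hf]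
  simpa using hP.le_of_harmonic hC hneg hj i

lemma isInvariantProb_invariantProb [DecidableEq A] [Nonempty A] {P : Matrix A A ℝ}
    (hP : IsTransitionMatrix P) : IsInvariantProb P (invariantProb P) :=
  Classical.epsilon_spec (exists_isInvariantProb hP)

/-- If `π` is an invariant probability measure of the indecomposable Markov matrix `P` and `Π` is
the matrix with rows `π`, then `I - P + Π` is invertible, and `(I - P + Π)⁻¹ - Π` is the
pseudo-inverse of `I - P`. -/
theorem exists_isPseudoInverse [DecidableEq A] [Nonempty A] {P : Matrix A A ℝ}
    (hP : IsTransitionMatrix P) (hI : IsIndecomposable P) : ∃ Q, IsPseudoInverse P Q := by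
  obtain ⟨⟨-, hp1⟩, hpP⟩ := isInvariantProb_invariantProb hP
  set p := invariantProb P with hp
  set Pm : Matrix A A ℝ := Matrix.of (fun _ j => p j) with hPm
  have hPm_vec : ∀ f : A → ℝ, Pm.mulVec f = fun _ => p ⬝ᵥ f := fun f => rfl
  have hPmP : Pm * P = Pm := by
    ext i j
    exact congrFun hpP j
  have hPPm : P * Pm = Pm := by
    ext i j
    simp [Matrix.mul_apply, hPm, ← Finset.sum_mul, (hP i).2]
  have hPmPm : Pm * Pm = Pm := by
    ext i j
    simp [Matrix.mul_apply, hPm, ← Finset.sum_mul, hp1]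
  have hdet : (1 - P + Pm).det ≠ 0 := by
    intro h0
    obtain ⟨f, hf0, hf⟩ := Matrix.exists_mulVec_eq_zero_iff.2 h0
    have h1 : Pm.mulVec f = 0 := by
      have : (Pm * (1 - P + Pm)).mulVec f = 0 := by
        rw [← Matrix.mulVec_mulVec, hf, Matrix.mulVec_zero]
      rwa [mul_add, mul_sub, mul_one, hPmP, hPmPm, sub_self, zero_add] at this
    have h2 : P.mulVec f = f := by
      rw [Matrix.add_mulVec, h1, add_zero, Matrix.sub_mulVec, Matrix.one_mulVec, sub_eq_zero] at hf
      exact hf.symm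
    obtain ⟨c, rfl⟩ := hI.harmonic_eq_const hP h2
    apply hf0
    have h3 := congrFun h1 (Classical.arbitrary A)
    rw [hPm_vec] at h3
    simp only [dotProduct, ← Finset.sum_mul, hp1, one_mul] at h3
    rw [h3]
    rfl
  have hu : IsUnit (1 - P + Pm).det := isUnit_iff_ne_zero.2 hdet
  set Z := (1 - P + Pm)⁻¹ with hZ
  have hZl : Z * (1 - P + Pm) = 1 := Matrix.nonsing_inv_mul _ hu
  have hZr : (1 - P + Pm) * Z = 1 := Matrix.mul_nonsing_inv _ hu
  have hMPm : (1 - P + Pm) * Pm = Pm := by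
    rw [add_mul, sub_mul, one_mul, hPPm, hPmPm, sub_self, zero_add]
  have hPmM : Pm * (1 - P + Pm) = Pm := by
    rw [mul_add, mul_sub, mul_one, hPmP, hPmPm, sub_self, zero_add]
  have hZPm : Z * Pm = Pm := by
    conv_lhs => rw [← hMPm, ← mul_assoc, hZl, one_mul]
  have hPmZ : Pm * Z = Pm := by
    conv_lhs => rw [← hPmM, mul_assoc, hZr, mul_one]
  have h1P : (1 : Matrix A A ℝ) - P = (1 - P + Pm) - Pm := by abel
  refine ⟨Z - Pm, ?_, ?_, ?_⟩
  · have h1 : Pm.mulVec (fun _ => (1 : ℝ)) = fun _ => 1 := by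
      rw [hPm_vec]; simp [dotProduct, hp1]
    have h2 : Z.mulVec (fun _ => (1 : ℝ)) = fun _ => 1 := by
      conv_lhs => rw [← h1]
      rw [Matrix.mulVec_mulVec, hZPm, h1]
    rw [Matrix.sub_mulVec, h1, h2, sub_self]
  · rw [h1P, mul_sub, sub_mul, sub_mul, hZl, hPmM, hZPm, hPmPm, sub_self, sub_zero]
  · rw [h1P, sub_mul, mul_sub, mul_sub, hZr, hMPm, hPmZ, hPmPm, sub_self, sub_zero]

/-- The Poisson equation: the oscillation of the rows of `V` around their stationary mean is
`(I - P) Q V`. -/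
theorem poisson_equation {R : Type*} [DecidableEq A] [Nonempty A] [Fintype R] {P : Matrix A A ℝ}
    (hP : IsTransitionMatrix P) (hI : IsIndecomposable P) (V : Matrix A R ℝ) (e : A) (r : R) :
    V e r - piV V P r =
      (pseudoInverse P * V) e r - ∑ e', P e e' * (pseudoInverse P * V) e' r := by
  have hQ : IsPseudoInverse P (pseudoInverse P) :=
    Classical.epsilon_spec (exists_isPseudoInverse hP hI)
  have h := congrArg (fun M : Matrix A A ℝ => (M * V) e r) hQ.2.2
  rw [sub_mul, one_mul, Matrix.sub_mul, Matrix.sub_mul, Matrix.one_mul, Matrix.mul_assoc,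
    Matrix.sub_apply, Matrix.sub_apply, Matrix.mul_apply (M := P)] at h
  rw [h]
  rfl

end Markov

/-! ### The nearest-point map of a compact convex set -/

section NearestPoint

variable {R : Type*} [Fintype R] {S : Set (EuclideanSpace ℝ R)}

lemma nearestPoint_spec (hne : S.Nonempty) (hS : IsCompact S) (v : EuclideanSpace ℝ R) :
    nearestPoint S v ∈ S ∧ ∀ u ∈ S, dist v (nearestPoint S v) ≤ dist v u := by
  obtain ⟨w, hw, hmin⟩ := hS.exists_isMinOn hne (f := fun u => dist v u) (by fun_prop)
  exact Classical.epsilon_spec (p := fun w => w ∈ S ∧ ∀ u ∈ S, dist v w ≤ dist v u)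
    ⟨w, hw, fun u hu => hmin hu⟩

lemma nearestPoint_of_mem (hS : IsCompact S) {v : EuclideanSpace ℝ R} (hv : v ∈ S) :
    nearestPoint S v = v := by
  have h := (nearestPoint_spec ⟨v, hv⟩ hS v).2 v hv
  rw [dist_self] at h
  exact (dist_le_zero.1 h).symm

lemma inner_sub_nearestPoint_nonpos (hne : S.Nonempty) (hS : IsCompact S) (hconv : Convex ℝ S)
    (v : EuclideanSpace ℝ R) {w : EuclideanSpace ℝ R} (hw : w ∈ S) :
    inner ℝ (v - nearestPoint S v) (w - nearestPoint S v) ≤ 0 := by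
  obtain ⟨hmem, hmin⟩ := nearestPoint_spec hne hS v
  refine (norm_eq_iInf_iff_real_inner_le_zero hconv hmem).1 ?_ w hw
  have : Nonempty S := ⟨⟨w, hw⟩⟩
  refine le_antisymm (le_ciInf fun u => ?_) (ciInf_le ⟨0, ?_⟩ (⟨_, hmem⟩ : S))
  · simpa [dist_eq_norm] using hmin u u.2
  · rintro _ ⟨u, rfl⟩
    exact norm_nonneg _

/-- The metric projection onto a convex set does not increase distances. -/
theorem lipschitzWith_nearestPoint (hne : S.Nonempty) (hS : IsCompact S) (hconv : Convex ℝ S) :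
    LipschitzWith 1 (nearestPoint S) := by
  refine LipschitzWith.of_dist_le_mul fun v w => ?_
  rw [NNReal.coe_one, one_mul, dist_eq_norm, dist_eq_norm]
  have h1 := inner_sub_nearestPoint_nonpos hne hS hconv v (nearestPoint_spec hne hS w).1
  have h2 := inner_sub_nearestPoint_nonpos hne hS hconv w (nearestPoint_spec hne hS v).1
  set a := nearestPoint S v
  set b := nearestPoint S w
  have h3 : ‖a - b‖ * ‖a - b‖ ≤ inner ℝ (v - w) (a - b) := by
    rw [← real_inner_self_eq_norm_mul_norm]
    have e1 : inner ℝ (v - a) (b - a) = - inner ℝ (v - a) (a - b) := by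
      rw [← inner_neg_right, neg_sub]
    have e2 : inner ℝ (v - w) (a - b) =
        inner ℝ (v - a) (a - b) - inner ℝ (w - b) (a - b) + inner ℝ (a - b) (a - b) := by
      rw [← inner_sub_left, ← inner_add_left]
      congr 1
      abel
    rw [e2]
    linarith
  have h4 : ‖a - b‖ * ‖a - b‖ ≤ ‖v - w‖ * ‖a - b‖ := h3.trans (real_inner_le_norm _ _)
  rcases (norm_nonneg (a - b)).eq_or_lt with h0 | h0
  · rw [← h0]; exact norm_nonneg _
  · exact le_of_mul_le_mul_right h4 h0

end NearestPoint

/-! ### The global flow of a Lipschitz vector field -/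

section Flow

open Set NNReal

variable {H : Type*} [NormedAddCommGroup H] [NormedSpace ℝ H]

/-- A time-dependent field which is Lipschitz in space and bounded on bounded time intervals has
global integral curves: the Picard–Lindelöf theorem gives a solution on each `[-T, T]`, and these
agree where they are both defined. -/
theorem exists_hasDerivAt_of_lipschitz_of_bounded [CompleteSpace H] {f : ℝ → H → H} {K : ℝ≥0}
    (hlip : ∀ t, LipschitzWith K (f t)) (hcont : ∀ x, Continuous fun t => f t x)
    (hbdd : ∀ T : ℝ, ∃ L : ℝ≥0, ∀ t ∈ Icc (-T) T, ∀ x, ‖f t x‖ ≤ L) (x : H) :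
    ∃ γ : ℝ → H, γ 0 = x ∧ ∀ t, HasDerivAt γ (f t (γ t)) t := by
  have hloc : ∀ T : ℝ, ∃ α : ℝ → H, 0 < T →
      α 0 = x ∧ ∀ t ∈ Ioo (-T) T, HasDerivAt α (f t (α t)) t := by
    intro T
    by_cases hT : 0 < T
    swap
    · exact ⟨fun _ => 0, fun h => absurd h hT⟩
    obtain ⟨L, hL⟩ := hbdd T
    have hpl : IsPicardLindelof f (⟨0, by simp [hT.le], hT.le⟩ : Icc (-T) T) x
        (L * T.toNNReal) 0 L K := by
      refine ⟨fun t _ => (hlip t).lipschitzOnWith, fun y _ => (hcont y).continuousOn,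
        fun t ht y _ => hL t ht y, ?_⟩
      simp [hT.le]
    obtain ⟨α, h0, hα⟩ := hpl.exists_eq_forall_mem_Icc_hasDerivWithinAt₀
    exact ⟨α, fun _ => ⟨h0, fun t ht =>
      (hα t (Ioo_subset_Icc_self ht)).hasDerivAt (Icc_mem_nhds ht.1 ht.2)⟩⟩
  choose α hα using hloc
  have hagree : ∀ S T t : ℝ, |t| < S → |t| < T → α S t = α T t := by
    intro S T t hS hT
    have hS0 : 0 < S := (abs_nonneg t).trans_lt hS
    have hT0 : 0 < T := (abs_nonneg t).trans_lt hT
    have hm : 0 < min S T := lt_min hS0 hT0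
    refine ODE_solution_unique_of_mem_Ioo (v := f) (s := fun _ => univ) (K := K) (t₀ := 0)
      (a := -min S T) (b := min S T) (fun t _ => (hlip t).lipschitzOnWith) ⟨by linarith, hm⟩
      (fun s hs => ⟨(hα S hS0).2 s ⟨?_, ?_⟩, mem_univ _⟩)
      (fun s hs => ⟨(hα T hT0).2 s ⟨?_, ?_⟩, mem_univ _⟩)
      ((hα S hS0).1.trans (hα T hT0).1.symm) (abs_lt.1 (lt_min hS hT))
    · linarith [hs.1, min_le_left S T]
    · linarith [hs.2, min_le_left S T]
    · linarith [hs.1, min_le_right S T]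
    · linarith [hs.2, min_le_right S T]
  refine ⟨fun t => α (|t| + 1) t, (hα _ (by positivity)).1, fun t => ?_⟩
  have ht : |t| < |t| + 1 := by linarith
  refine ((hα (|t| + 1) (by positivity)).2 t (abs_lt.1 ht)).congr_of_eventuallyEq ?_
  filter_upwards [(continuous_abs.tendsto t).eventually (gt_mem_nhds ht)] with s hs
  exact hagree _ _ s (by linarith) hs

/-- For `b` bounded and Lipschitz, the field `v ↦ -v + b v` has a global flow. The substitution
`w = eᵗ v` turns the equation into `w' = eᵗ b (e⁻ᵗ w)`, whose right-hand side is bounded on bounded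
time intervals. -/
theorem exists_isFlowOn_univ_neg_add [CompleteSpace H] {b : H → H} {K : ℝ≥0}
    (hb : LipschitzWith K b) {C : ℝ} (hC : ∀ x, ‖b x‖ ≤ C) :
    ∃ Φ : ℝ → H → H, IsFlowOn univ (fun v => -v + b v) Φ := by
  have hcurve : ∀ x : H, ∃ γ : ℝ → H, γ 0 = x ∧
      ∀ t, HasDerivAt γ (Real.exp t • b (Real.exp (-t) • γ t)) t := by
    refine exists_hasDerivAt_of_lipschitz_of_bounded (K := K) (f := fun t x =>
      Real.exp t • b (Real.exp (-t) • x)) (fun t => ?_) (fun x => ?_) (fun T => ?_)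
    · refine LipschitzWith.of_dist_le_mul fun x y => ?_
      rw [dist_smul₀, Real.norm_of_nonneg (Real.exp_pos t).le]
      have h := hb.dist_le_mul (Real.exp (-t) • x) (Real.exp (-t) • y)
      rw [dist_smul₀, Real.norm_of_nonneg (Real.exp_pos _).le] at h
      calc Real.exp t * dist (b (Real.exp (-t) • x)) (b (Real.exp (-t) • y))
          ≤ Real.exp t * (K * (Real.exp (-t) * dist x y)) := by gcongr
        _ = (Real.exp t * Real.exp (-t)) * (K * dist x y) := by ring
        _ = K * dist x y := by rw [← Real.exp_add, add_neg_cancel, Real.exp_zero, one_mul]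
    · have := hb.continuous
      fun_prop
    · have hC0 : 0 ≤ C := (norm_nonneg _).trans (hC 0)
      refine ⟨⟨Real.exp T * C, by positivity⟩, fun t ht x => ?_⟩
      rw [norm_smul, Real.norm_of_nonneg (Real.exp_pos t).le]
      change _ ≤ Real.exp T * C
      gcongr
      · exact ht.2
      · exact hC _
  choose γ hγ0 hγ using hcurve
  refine ⟨fun t x => Real.exp (-t) • γ x t, fun x _ => ⟨by simp [hγ0], fun t => ⟨mem_univ _, ?_⟩⟩⟩
  have h1 : HasDerivAt (fun s : ℝ => Real.exp (-s)) (-Real.exp (-t)) t := by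
    simpa using (hasDerivAt_neg t).exp
  refine (h1.smul (hγ x t)).congr_deriv ?_
  rw [smul_smul, ← Real.exp_add, neg_add_cancel, Real.exp_zero, one_smul, neg_smul, add_comm]

variable {F : H → H} {K : ℝ≥0} {M : Set H} {Φ : ℝ → H → H}

lemma IsFlowOn.mono {N : Set H} (hΦ : IsFlowOn M F Φ) (hN : N ⊆ M)
    (hinv : ∀ v ∈ N, ∀ t, Φ t v ∈ N) : IsFlowOn N F Φ :=
  fun v hv => ⟨(hΦ v (hN hv)).1, fun t => ⟨hinv v hv t, ((hΦ v (hN hv)).2 t).2⟩⟩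

lemma IsFlowOn.eq_of_hasDerivAt (hF : LipschitzWith K F) (hΦ : IsFlowOn M F Φ) {γ : ℝ → H}
    (hγ : ∀ t, HasDerivAt γ (F (γ t)) t) (h0 : γ 0 ∈ M) (t : ℝ) : γ t = Φ t (γ 0) := by
  have h := ODE_solution_unique_univ (v := fun _ => F) (s := fun _ => univ) (K := K) (t₀ := 0)
    (f := γ) (g := fun s => Φ s (γ 0)) (fun _ => hF.lipschitzOnWith)
    (fun t => ⟨hγ t, mem_univ _⟩) (fun t => ⟨((hΦ _ h0).2 t).2, mem_univ _⟩) ((hΦ _ h0).1).symm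
  exact congrFun h t

lemma IsFlowOn.map_add (hF : LipschitzWith K F) (hΦ : IsFlowOn univ F Φ) (s t : ℝ) (x : H) :
    Φ (s + t) x = Φ s (Φ t x) := by
  have h := hΦ.eq_of_hasDerivAt hF (γ := fun r => Φ (r + t) x)
    (fun r => (((hΦ x (mem_univ x)).2 (r + t)).2).comp_add_const r t) (mem_univ _) s
  simpa using h

lemma IsFlowOn.continuous_time (hΦ : IsFlowOn univ F Φ) (x : H) : Continuous fun t => Φ t x :=
  continuous_iff_continuousAt.2 fun t => ((hΦ x (mem_univ x)).2 t).2.continuousAt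

lemma IsFlowOn.dist_le (hF : LipschitzWith K F) (hΦ : IsFlowOn univ F Φ) {t : ℝ} (ht : 0 ≤ t)
    (x y : H) : dist (Φ t x) (Φ t y) ≤ dist x y * Real.exp (K * t) := by
  have h := dist_le_of_trajectories_ODE (v := fun _ => F) (K := K) (f := fun s => Φ s x)
    (g := fun s => Φ s y) (a := 0) (b := t) (δ := dist x y) (fun _ => hF)
    (hΦ.continuous_time x).continuousOn
    (fun s _ => ((hΦ x (mem_univ x)).2 s).2.hasDerivWithinAt)
    (hΦ.continuous_time y).continuousOn
    (fun s _ => ((hΦ y (mem_univ y)).2 s).2.hasDerivWithinAt)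
    (by rw [(hΦ x (mem_univ x)).1, (hΦ y (mem_univ y)).1]) t ⟨ht, le_rfl⟩
  simpa using h

lemma gronwallBound_zero_le {K ε t : ℝ} (hK0 : 0 ≤ K) (hε : 0 ≤ ε) :
    gronwallBound 0 K ε t ≤ t * (Real.exp (K * t) * ε) := by
  by_cases hK : K = 0
  · simp [hK, gronwallBound_K0, mul_comm]
  · have hKpos : 0 < K := lt_of_le_of_ne hK0 (Ne.symm hK)
    have h1 : Real.exp (K * t) - 1 ≤ K * t * Real.exp (K * t) := by
      have h := mul_le_mul_of_nonneg_right (Real.add_one_le_exp (-(K * t)))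
        (Real.exp_pos (K * t)).le
      rw [← Real.exp_add, neg_add_cancel, Real.exp_zero] at h
      linarith
    have h2 : ε / K * (Real.exp (K * t) - 1) ≤ ε / K * (K * t * Real.exp (K * t)) := by gcongr
    rw [gronwallBound_of_K_ne_0 hK]
    simp only [zero_mul, zero_add]
    refine h2.trans (le_of_eq ?_)
    field_simp

/-- The local error of an Euler step `x + h y` for the flow, where the increment `y` is close to
`F x`. -/
lemma IsFlowOn.dist_euler_step_le (hF : LipschitzWith K F) (hΦ : IsFlowOn univ F Φ) {h : ℝ}
    (hh : 0 ≤ h) (x y : H) :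
    dist (x + h • y) (Φ h x) ≤ h * (Real.exp (K * h) * (‖y - F x‖ + K * (h * ‖y‖))) := by
  have hd : ∀ s : ℝ, HasDerivAt (fun r : ℝ => x + r • y) y s := fun s => by
    simpa using ((hasDerivAt_id s).smul_const y).const_add x
  have hb := dist_le_of_approx_trajectories_ODE (v := fun _ => F) (K := K)
    (f := fun s : ℝ => x + s • y) (f' := fun _ => y) (g := fun s => Φ s x)
    (g' := fun s => F (Φ s x)) (a := 0) (b := h) (δ := 0) (εf := ‖y - F x‖ + K * (h * ‖y‖))
    (εg := 0) (fun _ => hF) (by fun_prop) (fun s _ => (hd s).hasDerivWithinAt) ?_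
    (hΦ.continuous_time x).continuousOn
    (fun s _ => ((hΦ x (mem_univ x)).2 s).2.hasDerivWithinAt) (fun s _ => by rw [dist_self])
    (by simp [(hΦ x (mem_univ x)).1]) h ⟨hh, le_rfl⟩
  · rw [add_zero, sub_zero] at hb
    exact hb.trans (gronwallBound_zero_le K.coe_nonneg (by positivity))
  · intro s hs
    refine (dist_triangle y (F x) _).trans ?_
    rw [dist_eq_norm]
    gcongr
    refine (hF.dist_le_mul _ _).trans ?_
    rw [dist_self_add_right, norm_smul, Real.norm_of_nonneg hs.1]
    gcongr
    exact hs.2.le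

end Flow

/-! ### Asymptotic trajectories of a flow -/

section AsymptoticTrajectory

open Set NNReal

variable {H : Type*} [NormedAddCommGroup H]

/-- The sequence `u`, observed at the times `t n`, is an asymptotic trajectory of `Φ`: over a time
window of any given length, the sequence eventually shadows the orbits of its own points. This is
the discrete form of an asymptotic pseudotrajectory. -/
def IsAsymptoticTrajectory (Φ : ℝ → H → H) (t : ℕ → ℝ) (u : ℕ → H) : Prop :=
  ∀ T η : ℝ, 0 < η → ∀ᶠ n in atTop, ∀ m ≥ n, t m - t n ≤ T →
    dist (u m) (Φ (t m - t n) (u n)) ≤ η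

variable [NormedSpace ℝ H] {F : H → H} {K : ℝ≥0} {Φ : ℝ → H → H}

/-- An Euler scheme with bounded increments and asymptotically vanishing errors and steps is an
asymptotic trajectory: the local errors are summed by the discrete Grönwall argument. -/
theorem IsFlowOn.isAsymptoticTrajectory_of_euler (hF : LipschitzWith K F)
    (hΦ : IsFlowOn univ F Φ) {t : ℕ → ℝ} (ht : Monotone t)
    (hstep : Tendsto (fun n => t (n + 1) - t n) atTop (𝓝 0)) {w y : ℕ → H}
    (hw : ∀ n, w (n + 1) = w n + (t (n + 1) - t n) • y n)
    (hy : Tendsto (fun n => y n - F (w n)) atTop (𝓝 0)) {C : ℝ} (hC : ∀ n, ‖y n‖ ≤ C) :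
    IsAsymptoticTrajectory Φ t w := by
  intro T η hη
  set h : ℕ → ℝ := fun n => t (n + 1) - t n with hh
  have hh0 : ∀ n, 0 ≤ h n := fun n => sub_nonneg.2 (ht n.le_succ)
  have hρ : Tendsto (fun n => Real.exp (K * h n) * (‖y n - F (w n)‖ + K * (h n * C)))
      atTop (𝓝 0) := by
    have h1 : Tendsto (fun n => Real.exp (K * h n)) atTop (𝓝 (Real.exp (K * 0))) :=
      (Real.continuous_exp.tendsto _).comp (hstep.const_mul _)
    have h2 := (tendsto_zero_iff_norm_tendsto_zero.1 hy).add
      ((hstep.mul_const C).const_mul (K : ℝ))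
    simpa using h1.mul h2
  have hB : 0 < (|T| + 1) * Real.exp (K * |T|) := by positivity
  have hη' : 0 < η / ((|T| + 1) * Real.exp (K * |T|)) := by positivity
  set δ := η / ((|T| + 1) * Real.exp (K * |T|)) with hδ
  obtain ⟨N, hN⟩ := eventually_atTop.1 (hρ.eventually (ge_mem_nhds hη'))
  filter_upwards [eventually_ge_atTop N] with n hn m hm hT
  have key : ∀ m ≥ n, dist (w m) (Φ (t m - t n) (w n)) ≤
      δ * ((t m - t n) * Real.exp (K * (t m - t n))) := by
    intro m hm
    induction m, hm using Nat.le_induction with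
    | base => simp [(hΦ (w n) (mem_univ _)).1]
    | succ m hm ih =>
      have hs : 0 ≤ t m - t n := sub_nonneg.2 (ht hm)
      have e1 : t (m + 1) - t n = h m + (t m - t n) := by simp only [hh]; ring
      rw [e1, hΦ.map_add hF]
      set s := t m - t n
      have d1 : dist (w (m + 1)) (Φ (h m) (w m)) ≤ h m * δ := by
        rw [hw m]
        refine (hΦ.dist_euler_step_le hF (hh0 m) _ _).trans ?_
        refine mul_le_mul_of_nonneg_left (le_trans ?_ (hN m (hn.trans hm))) (hh0 m)
        have := hh0 m
        gcongr
        exact hC m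
      have d2 := hΦ.dist_le hF (hh0 m) (w m) (Φ s (w n))
      have d3 : dist (w m) (Φ s (w n)) * Real.exp (K * h m) ≤
          δ * (s * Real.exp (K * s)) * Real.exp (K * h m) := by gcongr
      have e2 : δ * (s * Real.exp (K * s)) * Real.exp (K * h m) =
          δ * (s * Real.exp (K * (h m + s))) := by
        rw [mul_add, Real.exp_add]; ring
      have d4 : h m * δ ≤ δ * (h m * Real.exp (K * (h m + s))) := by
        rw [mul_comm]
        refine mul_le_mul_of_nonneg_left (le_mul_of_one_le_right (hh0 m) ?_) hη'.le
        exact Real.one_le_exp (mul_nonneg K.coe_nonneg (add_nonneg (hh0 m) hs))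
      have := dist_triangle (w (m + 1)) (Φ (h m) (w m)) (Φ (h m) (Φ s (w n)))
      linarith
  have hs : 0 ≤ t m - t n := sub_nonneg.2 (ht hm)
  have hsT : t m - t n ≤ |T| := hT.trans (le_abs_self T)
  calc dist (w m) (Φ (t m - t n) (w n))
      ≤ δ * ((t m - t n) * Real.exp (K * (t m - t n))) := key m hm
    _ ≤ δ * ((|T| + 1) * Real.exp (K * |T|)) := by gcongr; linarith
    _ = η := div_mul_cancel₀ _ hB.ne'

lemma IsAsymptoticTrajectory.of_tendsto_dist (hF : LipschitzWith K F) (hΦ : IsFlowOn univ F Φ)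
    {t : ℕ → ℝ} (ht : Monotone t) {u w : ℕ → H} (hw : IsAsymptoticTrajectory Φ t w)
    (huw : Tendsto (fun n => dist (u n) (w n)) atTop (𝓝 0)) : IsAsymptoticTrajectory Φ t u := by
  intro T η hη
  have hδ : 0 < η / 3 / Real.exp (K * |T|) := by positivity
  obtain ⟨N, hN⟩ := eventually_atTop.1 (huw.eventually (ge_mem_nhds hδ))
  have hle : η / 3 / Real.exp (K * |T|) ≤ η / 3 :=
    div_le_self (by positivity) (Real.one_le_exp (by positivity))
  filter_upwards [hw T (η / 3) (by positivity), eventually_ge_atTop N] with n h1 hn m hm hT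
  have hs : 0 ≤ t m - t n := sub_nonneg.2 (ht hm)
  have hsT : t m - t n ≤ |T| := hT.trans (le_abs_self T)
  have h2 : dist (Φ (t m - t n) (w n)) (Φ (t m - t n) (u n)) ≤ η / 3 := by
    refine (hΦ.dist_le hF hs _ _).trans ?_
    calc dist (w n) (u n) * Real.exp (K * (t m - t n))
        ≤ η / 3 / Real.exp (K * |T|) * Real.exp (K * |T|) := by
          rw [dist_comm]
          gcongr
          exact hN n hn
      _ = η / 3 := div_mul_cancel₀ _ (Real.exp_pos _).ne'
  have h3 := dist_triangle4 (u m) (w m) (Φ (t m - t n) (w n)) (Φ (t m - t n) (u n))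
  linarith [h1 m hm hT, hN m (hn.trans hm)]

/-- A stochastic approximation scheme whose noise is the sum of the increments of a convergent
sequence `s` and of a vanishing drift `r` is an asymptotic trajectory: subtracting from it the
remainder of `s` leaves an Euler scheme. -/
theorem IsFlowOn.isAsymptoticTrajectory (hF : LipschitzWith K F)
    (hΦ : IsFlowOn univ F Φ) {t : ℕ → ℝ} (ht : Monotone t)
    (hstep : Tendsto (fun n => t (n + 1) - t n) atTop (𝓝 0)) {u r s : ℕ → H}
    (hu : ∀ n, u (n + 1) = u n + (t (n + 1) - t n) • (F (u n) + r n) + (s (n + 1) - s n))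
    (hr : Tendsto r atTop (𝓝 0)) {l : H} (hs : Tendsto s atTop (𝓝 l)) {C : ℝ}
    (hC : ∀ n, ‖F (u n)‖ ≤ C) : IsAsymptoticTrajectory Φ t u := by
  obtain ⟨B, hB⟩ := hr.norm.bddAbove_range
  have hsl : Tendsto (fun n => s n - l) atTop (𝓝 0) := by simpa using hs.sub_const l
  refine IsAsymptoticTrajectory.of_tendsto_dist hF hΦ ht (w := fun n => u n - (s n - l)) ?_ ?_
  · refine hΦ.isAsymptoticTrajectory_of_euler hF ht hstep (y := fun n => F (u n) + r n)
      (fun n => ?_) ?_ (C := C + B) (fun n => ?_)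
    · simp only [hu n]
      abel
    · have h1 : Tendsto (fun n => F (u n) - F (u n - (s n - l))) atTop (𝓝 0) := by
        rw [tendsto_zero_iff_norm_tendsto_zero]
        refine squeeze_zero (fun _ => norm_nonneg _) (fun n => ?_)
          (by simpa using (tendsto_zero_iff_norm_tendsto_zero.1 hsl).const_mul (K : ℝ))
        have := hF.dist_le_mul (u n) (u n - (s n - l))
        rwa [dist_eq_norm, dist_eq_norm, sub_sub_cancel] at this
      have h2 := h1.add hr
      rw [add_zero] at h2
      refine h2.congr fun n => ?_
      abel
    · exact (norm_add_le _ _).trans (add_le_add (hC n) (hB ⟨n, rfl⟩))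
  · simpa [dist_eq_norm] using tendsto_zero_iff_norm_tendsto_zero.1 hsl

/-- Along an asymptotic trajectory, limits are transported by the flow. -/
lemma IsAsymptoticTrajectory.tendsto (hF : LipschitzWith K F) (hΦ : IsFlowOn univ F Φ)
    {t : ℕ → ℝ} (ht : Monotone t) {u : ℕ → H} (hu : IsAsymptoticTrajectory Φ t u)
    {n m : ℕ → ℕ} (hn : Tendsto n atTop atTop) (hnm : ∀ k, n k ≤ m k) {s : ℝ}
    (hs : Tendsto (fun k => t (m k) - t (n k)) atTop (𝓝 s)) {y : H}
    (hy : Tendsto (fun k => u (n k)) atTop (𝓝 y)) :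
    Tendsto (fun k => u (m k)) atTop (𝓝 (Φ s y)) := by
  have h1 : Tendsto (fun k => dist (u (m k)) (Φ (t (m k) - t (n k)) (u (n k)))) atTop (𝓝 0) := by
    refine Metric.tendsto_nhds.2 fun ε hε => ?_
    filter_upwards [hn.eventually (hu (s + 1) (ε / 2) (by positivity)),
      hs.eventually (ge_mem_nhds (lt_add_one s))] with k hk hk'
    rw [Real.dist_0_eq_abs, abs_of_nonneg dist_nonneg]
    linarith [hk (m k) (hnm k) hk']
  have h2 : Tendsto (fun k => dist (Φ (t (m k) - t (n k)) (u (n k)))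
      (Φ (t (m k) - t (n k)) y)) atTop (𝓝 0) := by
    have h3 : Tendsto (fun k => dist (u (n k)) y * Real.exp (K * (t (m k) - t (n k))))
        atTop (𝓝 (0 * Real.exp (K * s))) :=
      (tendsto_iff_dist_tendsto_zero.1 hy).mul
        ((Real.continuous_exp.tendsto _).comp (hs.const_mul _))
    rw [zero_mul] at h3
    exact squeeze_zero (fun _ => dist_nonneg)
      (fun k => hΦ.dist_le hF (sub_nonneg.2 (ht (hnm k))) _ _) h3
  have h3 : Tendsto (fun k => dist (Φ (t (m k) - t (n k)) y) (Φ s y)) atTop (𝓝 0) :=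
    tendsto_iff_dist_tendsto_zero.1 (((hΦ.continuous_time y).tendsto s).comp hs)
  refine tendsto_iff_dist_tendsto_zero.2 (squeeze_zero (fun _ => dist_nonneg)
    (fun k => dist_triangle4 _ _ _ _) (by simpa using (h1.add h2).add h3))

end AsymptoticTrajectory

/-! ### Limit sets of asymptotic trajectories -/

section LimitSet

lemma mem_seqLimitSet_iff {X : Type*} [TopologicalSpace X] [FirstCountableTopology X] {x : ℕ → X}
    {y : X} : y ∈ seqLimitSet x ↔ MapClusterPt y atTop x := by
  constructor
  · rintro ⟨n, hn, hy⟩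
    exact MapClusterPt.of_comp hn hy.mapClusterPt
  · intro h
    obtain ⟨ψ, hψ, hy⟩ := h.tendsto_subseq
    exact ⟨ψ, hψ.tendsto_atTop, hy⟩

lemma isClosed_seqLimitSet {X : Type*} [TopologicalSpace X] [FirstCountableTopology X]
    (x : ℕ → X) : IsClosed (seqLimitSet x) := by
  have : seqLimitSet x = {y | ClusterPt y (map x atTop)} :=
    Set.ext fun _ => mem_seqLimitSet_iff
  rw [this]
  exact isClosed_setOfPred_clusterPt

lemma seqLimitSet_subset {X : Type*} [TopologicalSpace X] {x : ℕ → X} {S : Set X}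
    (hS : IsClosed S) (hx : ∀ n, x n ∈ S) : seqLimitSet x ⊆ S := by
  rintro y ⟨n, -, hy⟩
  exact hS.mem_of_tendsto hy (Eventually.of_forall fun k => hx (n k))

lemma seqLimitSet_comp_add_one {X : Type*} [TopologicalSpace X] (x : ℕ → X) :
    seqLimitSet (fun n => x (n + 1)) = seqLimitSet x := by
  ext y
  constructor
  · rintro ⟨n, hn, hy⟩
    exact ⟨fun k => n k + 1, (tendsto_add_atTop_nat 1).comp hn, hy⟩
  · rintro ⟨n, hn, hy⟩
    refine ⟨fun k => n k - 1, (tendsto_sub_atTop_nat 1).comp hn, hy.congr' ?_⟩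
    filter_upwards [hn.eventually (eventually_ge_atTop 1)] with k hk
    rw [Nat.sub_add_cancel hk]

/-- A sequence in a compact set eventually stays in every neighbourhood of its limit set. -/
lemma eventually_exists_dist_lt_seqLimitSet {X : Type*} [PseudoMetricSpace X] {S : Set X}
    (hS : IsCompact S) {x : ℕ → X} (hx : ∀ n, x n ∈ S) {η : ℝ} (hη : 0 < η) :
    ∀ᶠ n in atTop, ∃ y ∈ seqLimitSet x, dist (x n) y < η := by
  by_contra hcon
  rw [not_eventually] at hcon
  have hclosed : IsCompact (S ∩ (Metric.thickening η (seqLimitSet x))ᶜ) :=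
    hS.inter_right Metric.isOpen_thickening.isClosed_compl
  obtain ⟨y, hy, hcl⟩ := hclosed.exists_mapClusterPt_of_frequently (hcon.mono fun n hn =>
    ⟨hx n, fun hmem => hn (Metric.mem_thickening_iff.1 hmem)⟩)
  exact hy.2 (Metric.self_subset_thickening hη _ (mem_seqLimitSet_iff.2 hcl))

/-- The index of the first observation time after a given real time. -/
lemma exists_first_index {t : ℕ → ℝ} (ht : Tendsto t atTop atTop) (hmono : Monotone t)
    (hstep : Tendsto (fun n => t (n + 1) - t n) atTop (𝓝 0)) :
    ∃ idx : ℝ → ℕ, GaloisConnection idx t ∧ Tendsto idx atTop atTop ∧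
      Tendsto (fun a => t (idx a) - a) atTop (𝓝 0) := by
  have hex : ∀ a, ∃ m, a ≤ t m := fun a => (ht.eventually_ge_atTop a).exists
  classical
  refine ⟨fun a => Nat.find (hex a), fun a m => ?_, ?_, ?_⟩
  · exact ⟨fun h => (Nat.find_spec (hex a)).trans (hmono h), fun h => Nat.find_min' _ h⟩
  · refine tendsto_atTop.2 fun N => ?_
    filter_upwards [eventually_gt_atTop (t N)] with a ha
    by_contra! hlt
    exact absurd ((Nat.find_spec (hex a)).trans (hmono hlt.le)) (not_le.2 ha)
  · refine Metric.tendsto_nhds.2 fun ε hε => ?_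
    obtain ⟨N, hN⟩ := eventually_atTop.1 (hstep.eventually (gt_mem_nhds hε))
    filter_upwards [eventually_gt_atTop (t (N + 1))] with a ha
    have hspec := Nat.find_spec (hex a)
    rw [Real.dist_0_eq_abs, abs_of_nonneg (sub_nonneg.2 hspec)]
    have hlt : N + 1 < Nat.find (hex a) := by
      by_contra! hle
      exact absurd (hspec.trans (hmono hle)) (not_le.2 ha)
    obtain ⟨m, hm⟩ : ∃ m, Nat.find (hex a) = m + 1 := Nat.exists_eq_succ_of_ne_zero (by omega)
    have h1 : t m < a := not_le.1 (Nat.find_min (hex a) (by omega))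
    have h2 := hN m (by omega)
    rw [hm]
    linarith

open Set NNReal

variable {H : Type*} [NormedAddCommGroup H] [NormedSpace ℝ H] {F : H → H} {K : ℝ≥0}
  {Φ : ℝ → H → H} {t : ℕ → ℝ} {u : ℕ → H} {S : Set H}

lemma IsAsymptoticTrajectory.isInvariantSet (hF : LipschitzWith K F) (hΦ : IsFlowOn univ F Φ)
    (hmono : StrictMono t) (ht : Tendsto t atTop atTop)
    (hstep : Tendsto (fun n => t (n + 1) - t n) atTop (𝓝 0))
    (hu : IsAsymptoticTrajectory Φ t u) (hS : IsCompact S) (huS : ∀ n, u n ∈ S) :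
    IsInvariantSet Φ (seqLimitSet u) := by
  obtain ⟨idx, hgc, hidx, herr⟩ := exists_first_index ht hmono.monotone hstep
  rintro y ⟨n, hn, hy⟩ s
  have htn : Tendsto (fun k => t (n k) + s) atTop atTop :=
    tendsto_atTop_add_const_right _ s (ht.comp hn)
  have herr' : Tendsto (fun k => t (idx (t (n k) + s)) - t (n k)) atTop (𝓝 s) := by
    have := (herr.comp htn).add_const s
    rw [zero_add] at this
    exact this.congr fun k => by simp only [Function.comp]; ring
  rcases le_total 0 s with hs | hs
  · refine ⟨fun k => idx (t (n k) + s), hidx.comp htn,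
      hu.tendsto hF hΦ hmono.monotone hn (fun k => ?_) herr' hy⟩
    have := hgc.le_u_l (t (n k) + s)
    exact hmono.le_iff_le.1 (by linarith)
  · -- Backwards in time, the orbit is recovered from a cluster point of the earlier observations.
    obtain ⟨z, -, ψ, hψ, hz⟩ := hS.tendsto_subseq (x := fun k => u (idx (t (n k) + s)))
      (fun k => huS _)
    have hm : Tendsto (fun k => idx (t (n (ψ k)) + s)) atTop atTop :=
      (hidx.comp htn).comp hψ.tendsto_atTop
    have hlim := hu.tendsto hF hΦ hmono.monotone hm (m := fun k => n (ψ k)) (s := -s)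
      (fun k => hgc.l_le (by linarith))
      (by simpa using (herr'.comp hψ.tendsto_atTop).neg) hz
    have hyz : y = Φ (-s) z := tendsto_nhds_unique (hy.comp hψ.tendsto_atTop) hlim
    have : Φ s y = z := by
      rw [hyz, ← hΦ.map_add hF, add_neg_cancel, (hΦ z (mem_univ z)).1]
    rw [this]
    exact ⟨_, hm, hz⟩

/-- The limit set `L` of a relatively compact asymptotic trajectory is attractor free. Assume that
`B ≠ L` is an attractor, which attracts in time `T` the points of `L` close to `B`. The sequence
comes close to `B`; the point where it does so is close to `L`, so that its orbit, hence the
sequence itself, is again close to `B` during `[T, 2T+1]`, and then forever by induction. All the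
limits are then close to `B`, although some point of `L` is not. -/
theorem IsAsymptoticTrajectory.isAttractorFree (hF : LipschitzWith K F) (hΦ : IsFlowOn univ F Φ)
    (hmono : StrictMono t) (ht : Tendsto t atTop atTop)
    (hstep : Tendsto (fun n => t (n + 1) - t n) atTop (𝓝 0))
    (hu : IsAsymptoticTrajectory Φ t u) (hS : IsCompact S) (huS : ∀ n, u n ∈ S) :
    IsAttractorFree Φ (seqLimitSet u) := by
  refine ⟨isClosed_seqLimitSet u, hu.isInvariantSet hF hΦ hmono ht hstep hS huS, ?_⟩
  rintro ⟨B, hne, hBL, ⟨b₀, hb₀⟩, hBc, -, U, hU, ε₀, hε₀, τ, hτ⟩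
  obtain ⟨idx, hgc, hidx, herr⟩ := exists_first_index ht hmono.monotone hstep
  obtain ⟨p, hpL, hpB⟩ : ∃ p ∈ seqLimitSet u, p ∉ B :=
    not_subset.1 fun h => hne (hBL.antisymm h)
  obtain ⟨O, hO, hBO, hOU⟩ := mem_nhdsSet_iff_exists.1 hU
  obtain ⟨δ₁, hδ₁, hδ₁O⟩ := hBc.exists_thickening_subset_open hO hBO
  have hp0 : 0 < Metric.infDist p B :=
    (hBc.isClosed.notMem_iff_infDist_pos ⟨b₀, hb₀⟩).1 hpB
  -- `2 δ`-close points of `L` are attracted, and `p` is not `δ`-close to `B`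
  obtain ⟨δ, hδ, hδ1, hδp⟩ : ∃ δ > 0, 2 * δ ≤ δ₁ ∧ δ < Metric.infDist p B :=
    ⟨min (δ₁ / 2) (Metric.infDist p B / 2), by positivity,
      by linarith [min_le_left (δ₁ / 2) (Metric.infDist p B / 2)],
      by linarith [min_le_right (δ₁ / 2) (Metric.infDist p B / 2)]⟩
  obtain ⟨ε, hε, hεε₀, hεδ⟩ : ∃ ε > 0, ε < ε₀ ∧ ε ≤ δ / 2 :=
    ⟨min (ε₀ / 2) (δ / 2), by positivity, by linarith [min_le_left (ε₀ / 2) (δ / 2)],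
      min_le_right _ _⟩
  obtain ⟨hτ0, hattr⟩ := hτ ε hε hεε₀
  set T := τ ε with hT
  obtain ⟨η, hη, hηδ, hηδ'⟩ : ∃ η > 0, η ≤ δ ∧ η + η * Real.exp (K * (2 * T + 1)) ≤ δ / 2 := by
    refine ⟨δ / 2 / (1 + Real.exp (K * (2 * T + 1))), by positivity, ?_, le_of_eq ?_⟩
    · have h1 : 1 ≤ 1 + Real.exp (K * (2 * T + 1)) := by linarith [Real.exp_pos (K * (2 * T + 1))]
      exact (div_le_self (by positivity) h1).trans (by linarith)
    · have : 1 + Real.exp (K * (2 * T + 1)) ≠ 0 := by positivity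
      field_simp
  obtain ⟨N, hN⟩ := eventually_atTop.1
    ((hu (2 * T + 1) η hη).and (eventually_exists_dist_lt_seqLimitSet hS huS hη))
  have hwindow : ∀ n ≥ N, u n ∈ Metric.thickening δ B → ∀ m ≥ n, T ≤ t m - t n →
      t m - t n ≤ 2 * T + 1 → u m ∈ Metric.thickening δ B := by
    intro n hn hnB m hm h1 h2
    obtain ⟨w, hwL, hw⟩ := (hN n hn).2
    obtain ⟨b, hb, hnb⟩ := Metric.mem_thickening_iff.1 hnB
    have hwU : w ∈ U := by
      refine hOU (hδ₁O (Metric.mem_thickening_iff.2 ⟨b, hb, ?_⟩))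
      have := dist_triangle_left w b (u n)
      linarith
    obtain ⟨b', hb', hwb'⟩ := Metric.mem_thickening_iff.1 (hattr _ h1 w ⟨hwU, hwL⟩)
    refine Metric.mem_thickening_iff.2 ⟨b', hb', ?_⟩
    have h3 : dist (Φ (t m - t n) (u n)) (Φ (t m - t n) w) ≤ η * Real.exp (K * (2 * T + 1)) := by
      refine (hΦ.dist_le hF (hτ0.trans h1) _ _).trans ?_
      gcongr
    have h4 := (hN n hn).1 m hm h2
    have h5 := dist_triangle4 (u m) (Φ (t m - t n) (u n)) (Φ (t m - t n) w) b'
    linarith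
  obtain ⟨A, hA⟩ := eventually_atTop.1 (herr.eventually (gt_mem_nhds one_pos))
  -- a visit of the sequence to the neighbourhood of `B`
  obtain ⟨n₀, hn₀N, hn₀A, hn₀B⟩ : ∃ n ≥ N, A ≤ t n ∧ u n ∈ Metric.thickening δ B := by
    have hfreq : ∃ᶠ n in atTop, u n ∈ Metric.thickening δ B :=
      (mem_seqLimitSet_iff.1 (hBL hb₀)).frequently
        (Metric.isOpen_thickening.mem_nhds (Metric.self_subset_thickening hδ B hb₀))
    obtain ⟨n, hn, h1, h2⟩ := (hfreq.and_eventually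
      ((eventually_ge_atTop N).and (ht.eventually_ge_atTop A))).exists
    exact ⟨n, h1, h2, hn⟩
  have hforever : ∀ m, t n₀ + T ≤ t m → u m ∈ Metric.thickening δ B := by
    intro m
    induction m using Nat.strong_induction_on with
    | _ m ih =>
      intro hm
      have hle : ∀ {a b : ℕ}, t a ≤ t b → a ≤ b := fun h => hmono.le_iff_le.1 h
      by_cases h2 : t m - t n₀ ≤ 2 * T + 1
      · exact hwindow n₀ hn₀N hn₀B m (hle (by linarith)) (by linarith) h2
      · push Not at h2
        have h3 : t m - T - 1 ≤ t (idx (t m - T - 1)) := hgc.le_u_l _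
        have h4 := hA (t m - T - 1) (by linarith)
        have h5 : idx (t m - T - 1) < m := hmono.lt_iff_lt.1 (by linarith)
        exact hwindow _ (hn₀N.trans (hle (by linarith))) (ih _ h5 (by linarith)) m h5.le
          (by linarith) (by linarith)
  have hpcl : p ∈ closure (Metric.thickening δ B) := by
    obtain ⟨n, hn, hp⟩ := hpL
    refine mem_closure_of_tendsto hp ?_
    filter_upwards [(ht.comp hn).eventually_ge_atTop (t n₀ + T)] with k hk
    exact hforever _ hk
  have hple := Metric.closure_thickening_subset_cthickening δ B hpcl
  have : Metric.infDist p B ≤ δ :=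
    ENNReal.toReal_le_of_le_ofReal hδ.le (Metric.mem_cthickening_iff.1 hple)
  linarith

end LimitSet

/-! ### Almost sure convergence of bounded martingale differences -/

section MartingaleDifferences

variable {Ω : Type*} {mΩ : MeasurableSpace Ω} {μ : Measure Ω} [IsProbabilityMeasure μ]
  {𝒢 : Filtration ℕ mΩ}

/-- Martingale differences bounded by square-summable constants have almost surely convergent
partial sums: by orthogonality these form a martingale bounded in `L²`. -/
theorem ae_exists_tendsto_sum_of_condExp_eq_zero {D : ℕ → Ω → ℝ} {c : ℕ → ℝ}
    (hmeas : ∀ k, StronglyMeasurable[𝒢 (k + 1)] (D k))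
    (hbdd : ∀ k, ∀ᵐ ω ∂μ, |D k ω| ≤ c k) (hcond : ∀ k, μ[D k | 𝒢 k] =ᵐ[μ] 0)
    (hc : Summable fun k => c k ^ 2) :
    ∀ᵐ ω ∂μ, ∃ l, Tendsto (fun n => ∑ k ∈ Finset.range n, D k ω) atTop (𝓝 l) := by
  set M : ℕ → Ω → ℝ := fun n ω => ∑ k ∈ Finset.range n, D k ω with hM
  have hDm : ∀ k, AEStronglyMeasurable (D k) μ := fun k =>
    ((hmeas k).mono (𝒢.le _)).aestronglyMeasurable
  have hDi : ∀ k, Integrable (D k) μ := fun k =>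
    Integrable.of_bound (hDm k) (c k) (by simpa using hbdd k)
  have hMa : StronglyAdapted 𝒢 M := fun n =>
    Finset.stronglyMeasurable_fun_sum _ fun k hk =>
      (hmeas k).mono (𝒢.mono (Finset.mem_range.1 hk))
  have hMm : ∀ n, AEStronglyMeasurable (M n) μ := fun n =>
    ((hMa n).mono (𝒢.le _)).aestronglyMeasurable
  have hMb : ∀ n, ∀ᵐ ω ∂μ, ‖M n ω‖ ≤ ∑ k ∈ Finset.range n, c k := by
    intro n
    filter_upwards [ae_all_iff.2 hbdd] with ω hω
    exact (norm_sum_le _ _).trans (Finset.sum_le_sum fun k _ => hω k)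
  have hMi : ∀ n, Integrable (M n) μ := fun n => Integrable.of_bound (hMm n) _ (hMb n)
  have hsucc : ∀ n, M (n + 1) = M n + D n := fun n => by
    funext ω
    simp [hM, Finset.sum_range_succ]
  have hmart : Martingale M 𝒢 μ := by
    refine martingale_nat hMa hMi fun n => ?_
    rw [hsucc]
    have h1 := condExp_add (hMi n) (hDi n) (𝒢 n)
    rw [condExp_of_stronglyMeasurable (𝒢.le n) (hMa n) (hMi n)] at h1
    filter_upwards [h1, hcond n] with ω h2 h3
    simp [h2, h3]
  have hMDi : ∀ n, Integrable (M n * D n) μ := fun n => (hDi n).bdd_mul (hMm n) (hMb n)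
  have horth : ∀ n, ∫ ω, M n ω * D n ω ∂μ = 0 := by
    intro n
    have h1 : μ[M n * D n | 𝒢 n] =ᵐ[μ] M n * μ[D n | 𝒢 n] :=
      condExp_mul_of_stronglyMeasurable_left (hMa n) (hMDi n) (hDi n)
    have h2 : μ[M n * D n | 𝒢 n] =ᵐ[μ] 0 := by
      filter_upwards [h1, hcond n] with ω h3 h4
      simp [h3, h4]
    calc ∫ ω, M n ω * D n ω ∂μ = ∫ ω, (μ[M n * D n | 𝒢 n]) ω ∂μ :=
          (integral_condExp (𝒢.le n)).symm
      _ = 0 := by rw [integral_congr_ae h2]; simp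
  have hM2i : ∀ n, Integrable (fun ω => M n ω ^ 2) μ := fun n => by
    simpa [pow_two] using (hMi n).bdd_mul (hMm n) (hMb n)
  have hD2i : ∀ n, Integrable (fun ω => D n ω ^ 2) μ := fun n => by
    simpa [pow_two] using (hDi n).bdd_mul (hDm n) (hbdd n)
  have hL2 : ∀ n, ∫ ω, M n ω ^ 2 ∂μ ≤ ∑ k ∈ Finset.range n, c k ^ 2 := by
    intro n
    induction n with
    | zero => simp [hM]
    | succ n ih =>
      have h1 : ∀ ω, M (n + 1) ω ^ 2 = M n ω ^ 2 + D n ω ^ 2 + 2 * (M n ω * D n ω) := fun ω => by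
        rw [hsucc, Pi.add_apply]; ring
      have h2 : ∫ ω, D n ω ^ 2 ∂μ ≤ c n ^ 2 := by
        calc ∫ ω, D n ω ^ 2 ∂μ ≤ ∫ _, c n ^ 2 ∂μ := by
              refine integral_mono_ae (hD2i n) (integrable_const _) ?_
              filter_upwards [hbdd n] with ω hω
              exact sq_le_sq' (neg_le_of_abs_le hω) (le_of_abs_le hω)
          _ = c n ^ 2 := by simp
      simp only [h1]
      rw [integral_add (f := fun ω => M n ω ^ 2 + D n ω ^ 2) (g := fun ω => 2 * (M n ω * D n ω))
          ((hM2i n).add (hD2i n)) ((hMDi n).const_mul 2),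
        integral_add (hM2i n) (hD2i n), integral_const_mul, horth, mul_zero, add_zero,
        Finset.sum_range_succ]
      exact add_le_add ih h2
  have hL1 : ∀ n, ∫ ω, ‖M n ω‖ ∂μ ≤ (1 + ∑' k, c k ^ 2) / 2 := by
    intro n
    calc ∫ ω, ‖M n ω‖ ∂μ ≤ ∫ ω, (1 + M n ω ^ 2) / 2 ∂μ := by
          refine integral_mono (hMi n).norm (((integrable_const 1).add (hM2i n)).div_const 2)
            fun ω => ?_
          have := sq_nonneg (|M n ω| - 1)
          have h2 := sq_abs (M n ω)
          rw [Real.norm_eq_abs]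
          change |M n ω| ≤ (1 + M n ω ^ 2) / 2
          nlinarith
      _ = (1 + ∫ ω, M n ω ^ 2 ∂μ) / 2 := by
          rw [integral_div, integral_add (integrable_const 1) (hM2i n)]
          simp
      _ ≤ (1 + ∑' k, c k ^ 2) / 2 := by
          have := (hL2 n).trans (hc.sum_le_tsum _ fun k _ => sq_nonneg _)
          linarith
  have hbound : ∀ n, eLpNorm (M n) 1 μ ≤ ((1 + ∑' k, c k ^ 2) / 2).toNNReal := by
    intro n
    rw [eLpNorm_one_eq_lintegral_enorm, ← ofReal_integral_norm_eq_lintegral_enorm (hMi n)]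
    exact ENNReal.ofReal_le_ofReal (hL1 n)
  exact hmart.submartingale.exists_ae_tendsto_of_bdd hbound

/-- The fluctuations of bounded variables around their conditional expectations, with predictable
square-summable weights, have almost surely convergent sums. -/
theorem ae_exists_tendsto_sum_mul_sub_condExp {a Y : ℕ → Ω → ℝ} {c : ℕ → ℝ}
    (ha : ∀ k, StronglyMeasurable[𝒢 k] (a k)) (hac : ∀ k ω, |a k ω| ≤ c k)
    (hY : ∀ k, StronglyMeasurable[𝒢 (k + 1)] (Y k)) (hY1 : ∀ k ω, |Y k ω| ≤ 1)
    (hc : Summable fun k => c k ^ 2) :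
    ∀ᵐ ω ∂μ, ∃ l, Tendsto
      (fun n => ∑ k ∈ Finset.range n, a k ω * (Y k ω - (μ[Y k | 𝒢 k]) ω)) atTop (𝓝 l) := by
  have hYi : ∀ k, Integrable (Y k) μ := fun k =>
    Integrable.of_bound ((hY k).mono (𝒢.le _)).aestronglyMeasurable 1
      (Eventually.of_forall (hY1 k))
  refine ae_exists_tendsto_sum_of_condExp_eq_zero (μ := μ) (𝒢 := 𝒢)
    (D := fun k ω => a k ω * (Y k ω - (μ[Y k | 𝒢 k]) ω)) (c := fun k => c k * 2)
    (fun k => ?_) (fun k => ?_) (fun k => ?_) ?_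
  · exact ((ha k).mono (𝒢.mono k.le_succ)).mul
      ((hY k).sub (stronglyMeasurable_condExp.mono (𝒢.mono k.le_succ)))
  · have h1 : ∀ᵐ ω ∂μ, |(μ[Y k | 𝒢 k]) ω| ≤ 1 :=
      ae_bdd_abs_condExp_of_ae_bdd_abs (Eventually.of_forall (hY1 k))
    filter_upwards [h1] with ω hω
    rw [abs_mul]
    have h2 := abs_sub (Y k ω) ((μ[Y k | 𝒢 k]) ω)
    have h3 := hY1 k ω
    exact mul_le_mul (hac k ω) (by linarith) (abs_nonneg _) ((abs_nonneg _).trans (hac k ω))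
  · have hdi : Integrable (Y k - μ[Y k | 𝒢 k]) μ := (hYi k).sub integrable_condExp
    have hai : Integrable (a k * (Y k - μ[Y k | 𝒢 k])) μ :=
      hdi.bdd_mul ((ha k).mono (𝒢.le _)).aestronglyMeasurable
        (Eventually.of_forall (hac k))
    have h1 := condExp_mul_of_stronglyMeasurable_left (ha k) hai hdi
    have h2 := condExp_sub (hYi k) (integrable_condExp (m := 𝒢 k) (f := Y k) (μ := μ)) (𝒢 k)
    rw [condExp_of_stronglyMeasurable (𝒢.le k) (f := μ[Y k | 𝒢 k]) stronglyMeasurable_condExp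
      integrable_condExp] at h2
    filter_upwards [h1, h2] with ω h3 h4
    refine h3.trans ?_
    rw [Pi.mul_apply, h4]
    simp
  · simpa [mul_pow] using hc.mul_right (2 ^ 2)

end MartingaleDifferences

/-! ### Abel summation and harmonic steps -/

section Steps

/-- The sums `∑ γₖ (bₖ - bₖ₊₁)` converge when `b` is bounded and `γ` decreases to zero. -/
lemma exists_tendsto_sum_smul_sub_succ {H : Type*} [NormedAddCommGroup H] [NormedSpace ℝ H]
    [CompleteSpace H] {γ : ℕ → ℝ} (hγ : Antitone γ) (hγ0 : Tendsto γ atTop (𝓝 0))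
    {b : ℕ → H} {C : ℝ} (hb : ∀ k, ‖b k‖ ≤ C) :
    ∃ l, Tendsto (fun n => ∑ k ∈ Finset.range n, γ k • (b k - b (k + 1))) atTop (𝓝 l) := by
  have hsum : Summable fun k => (γ (k + 1) - γ k) • b (k + 1) := by
    have h1 : Summable fun k => γ k - γ (k + 1) := by
      refine summable_of_sum_range_le (c := γ 0) (fun k => sub_nonneg.2 (hγ k.le_succ)) fun n => ?_
      rw [Finset.sum_range_sub']
      linarith [hγ.le_of_tendsto hγ0 n]
    refine Summable.of_norm_bounded (h1.mul_right C) fun k => ?_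
    rw [norm_smul, Real.norm_eq_abs, abs_sub_comm, abs_of_nonneg (sub_nonneg.2 (hγ k.le_succ))]
    exact mul_le_mul_of_nonneg_left (hb _) (sub_nonneg.2 (hγ k.le_succ))
  have hbz : Tendsto (fun n => γ n • b n) atTop (𝓝 0) := by
    rw [tendsto_zero_iff_norm_tendsto_zero]
    refine squeeze_zero (fun _ => norm_nonneg _) (fun n => ?_) (by simpa using hγ0.mul_const C)
    rw [norm_smul, Real.norm_of_nonneg (hγ.le_of_tendsto hγ0 n)]
    exact mul_le_mul_of_nonneg_left (hb n) (hγ.le_of_tendsto hγ0 n)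
  refine ⟨_, ((tendsto_const_nhds (x := γ 0 • b 0)).sub hbz |>.add
    hsum.hasSum.tendsto_sum_nat).congr fun n => ?_⟩
  rw [← Finset.sum_range_sub' (fun k => γ k • b k), ← Finset.sum_add_distrib]
  refine Finset.sum_congr rfl fun k _ => ?_
  module

variable (c : ℕ)

lemma antitone_harmonic_step : Antitone fun k : ℕ => ((k : ℝ) + 2 + c)⁻¹ := by
  intro m n h
  have : (m : ℝ) ≤ n := by exact_mod_cast h
  dsimp only
  gcongr

lemma tendsto_harmonic_step : Tendsto (fun k : ℕ => ((k : ℝ) + 2 + c)⁻¹) atTop (𝓝 0) := by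
  refine tendsto_inv_atTop_zero.comp ?_
  exact tendsto_atTop_add_const_right _ _
    (tendsto_atTop_add_const_right _ _ tendsto_natCast_atTop_atTop)

lemma summable_sq_harmonic_step : Summable fun k : ℕ => ((k : ℝ) + 2 + c)⁻¹ ^ 2 := by
  have h := (summable_nat_add_iff (2 + c)).2 (Real.summable_nat_pow_inv.2 one_lt_two)
  refine h.congr fun k => ?_
  push_cast
  rw [inv_pow, add_assoc]

lemma tendsto_sum_harmonic_step :
    Tendsto (fun n => ∑ k ∈ Finset.range n, ((k : ℝ) + 2 + c)⁻¹) atTop atTop := by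
  refine (not_summable_iff_tendsto_nat_atTop_of_nonneg fun k => by positivity).1 fun h => ?_
  refine Real.not_summable_natCast_inv ((summable_nat_add_iff (2 + c)).1 (h.congr fun k => ?_))
  push_cast
  rw [add_assoc]

end Steps

/-! ### Removal of Markovian noise by the Poisson equation -/

section MarkovNoise

lemma exists_norm_le_of_continuousOn {A X H : Type*} [Finite A] [TopologicalSpace X]
    [SeminormedAddCommGroup H] {S : Set X} (hS : IsCompact S) {f : A → X → H}
    (hf : ∀ e, ContinuousOn (f e) S) : ∃ C, ∀ e, ∀ v ∈ S, ‖f e v‖ ≤ C := by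
  choose B hB using fun e => hS.exists_bound_of_continuousOn (hf e)
  obtain ⟨C, hC⟩ := (Set.finite_range B).bddAbove
  exact ⟨C, fun e v hv => (hB e v hv).trans (hC ⟨e, rfl⟩)⟩

/-- A stochastic approximation scheme driven by a process `ξ` with finitely many values, whose noise
is `G - L` at the new value of `ξ`, where `G` solves a Poisson equation and `L` is its image under
the transition matrix. The noise is the martingale difference `G (ξₖ₊₁) - L (ξₖ)`, whose weighted
sums are assumed to converge, plus an increment of `k ↦ L (ξₖ)(uₖ)`, whose weighted sums converge by
Abel summation, plus the vanishing effect on `L` of the step from `uₖ` to `uₖ₊₁`. -/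
theorem IsFlowOn.isAsymptoticTrajectory_of_markov_noise {A H : Type*} [Fintype A]
    [NormedAddCommGroup H] [NormedSpace ℝ H] [CompleteSpace H] {F : H → H} {K : NNReal}
    {Φ : ℝ → H → H} (hF : LipschitzWith K F) (hΦ : IsFlowOn Set.univ F Φ) {γ : ℕ → ℝ}
    (hγ : Antitone γ) (hγ0 : Tendsto γ atTop (𝓝 0)) {S : Set H} (hS : IsCompact S) {u : ℕ → H}
    (huS : ∀ k, u k ∈ S) {ξ : ℕ → A} {G L : A → H → H} (hG : ∀ e, ContinuousOn (G e) S)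
    (hL : ∀ e, ContinuousOn (L e) S)
    (hu : ∀ k, u (k + 1) = u k + γ k • (F (u k) + (G (ξ (k + 1)) (u k) - L (ξ (k + 1)) (u k))))
    {l : H} (hmart : Tendsto
      (fun n => ∑ k ∈ Finset.range n, γ k • (G (ξ (k + 1)) (u k) - L (ξ k) (u k))) atTop (𝓝 l)) :
    IsAsymptoticTrajectory Φ (fun n => ∑ k ∈ Finset.range n, γ k) u := by
  have hγnn : ∀ k, 0 ≤ γ k := fun k => hγ.le_of_tendsto hγ0 k
  obtain ⟨C, hC⟩ := exists_norm_le_of_continuousOn (A := Unit) hS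
    (fun _ => hF.continuous.continuousOn)
  obtain ⟨B, hB⟩ := exists_norm_le_of_continuousOn hS hL
  obtain ⟨J, hJ⟩ := exists_norm_le_of_continuousOn hS
    (fun e => hF.continuous.continuousOn.add ((hG e).sub (hL e)))
  obtain ⟨l', hl'⟩ := exists_tendsto_sum_smul_sub_succ hγ hγ0 (b := fun k => L (ξ k) (u k))
    (fun k => hB _ _ (huS k))
  have hinc : Tendsto (fun k => dist (u k) (u (k + 1))) atTop (𝓝 0) := by
    refine squeeze_zero (fun _ => dist_nonneg) (fun k => ?_) (by simpa using hγ0.mul_const J)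
    rw [hu k, dist_self_add_right, norm_smul, Real.norm_of_nonneg (hγnn k)]
    exact mul_le_mul_of_nonneg_left (hJ _ _ (huS k)) (hγnn k)
  have hvar : ∀ e, Tendsto (fun k => ‖L e (u (k + 1)) - L e (u k)‖) atTop (𝓝 0) := by
    intro e
    have huc := Metric.uniformContinuousOn_iff.1 (hS.uniformContinuousOn_of_continuous (hL e))
    refine Metric.tendsto_nhds.2 fun ε hε => ?_
    obtain ⟨δ, hδ, h⟩ := huc ε hε
    filter_upwards [hinc.eventually (gt_mem_nhds hδ)] with k hk
    rw [Real.dist_0_eq_abs, abs_norm, ← dist_eq_norm, dist_comm]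
    exact h _ (huS k) _ (huS (k + 1)) hk
  refine hΦ.isAsymptoticTrajectory hF
    (monotone_nat_of_le_succ fun n => by simp [Finset.sum_range_succ, hγnn])
    (by simpa [Finset.sum_range_succ] using hγ0)
    (r := fun k => L (ξ (k + 1)) (u (k + 1)) - L (ξ (k + 1)) (u k))
    (s := fun n => ∑ k ∈ Finset.range n, γ k • (G (ξ (k + 1)) (u k) - L (ξ k) (u k)) +
      ∑ k ∈ Finset.range n, γ k • (L (ξ k) (u k) - L (ξ (k + 1)) (u (k + 1))))
    (fun k => ?_) ?_ (hmart.add hl') (C := C) (fun k => hC () _ (huS k))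
  · simp only [Finset.sum_range_succ]
    refine (hu k).trans ?_
    module
  · rw [tendsto_zero_iff_norm_tendsto_zero]
    refine squeeze_zero (fun _ => norm_nonneg _) (fun k => ?_)
      (by simpa using tendsto_finsetSum Finset.univ fun e _ => hvar e)
    exact Finset.single_le_sum (f := fun e => ‖L e (u (k + 1)) - L e (u k)‖)
      (fun e _ => norm_nonneg _) (Finset.mem_univ (ξ (k + 1)))

end MarkovNoise

/-! ### The martingale part of the reinforced walk -/

namespace EdgeWalk

variable {Ω : Type*} {mΩ : MeasurableSpace Ω} {ℙ : Measure Ω} {ℱ : Filtration ℕ mΩ}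
  {𝒳 : Type*} [Finite 𝒳] {E : Set (Sym2 𝒳)} {R : Type*} [Fintype R]

lemma measurable_reinforcement (W : EdgeWalk ℙ ℱ E R) (n : ℕ) :
    Measurable[ℱ n] (W.reinforcement n) := by
  have h : ∀ k ∈ Finset.Icc 1 n, Measurable[ℱ n] fun ω => W.V k ω := by
    intro k hk
    have h1 : Measurable[ℱ k] fun ω r => W.V k ω r :=
      @measurable_pi_lambda _ _ _ (ℱ k) _ _ (W.measurable_V k)
    exact ((WithLp.measurable_toLp 2 (R → ℝ)).comp h1).mono
      (ℱ.mono (Finset.mem_Icc.1 hk).2) le_rfl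
  have h2 : Measurable[ℱ n] fun ω => WithLp.toLp 2 (fun _ : R => (1 : ℝ)) +
      ∑ k ∈ Finset.Icc 1 n, W.V k ω := measurable_const.add (Finset.measurable_fun_sum _ h)
  exact h2.const_smul ((n : ℝ) + Fintype.card R)⁻¹

/-- For continuous bounded functions `G e`, the fluctuation of `G` at the new edge around its
conditional expectation given by the transition matrix has convergent weighted sums. -/
theorem ae_exists_tendsto_sum_fluctuation [IsProbabilityMeasure ℙ] (W : EdgeWalk ℙ ℱ E R)
    {G : OrientedEdge E → EuclideanSpace ℝ R → EuclideanSpace ℝ R} (hG : ∀ e, Continuous (G e))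
    {C : ℝ} (hC : ∀ e v, ‖G e v‖ ≤ C) {γ : ℕ → ℝ} (hγ : Summable fun k => γ k ^ 2) :
    ∀ᵐ ω ∂ℙ, ∃ l, Tendsto (fun n => ∑ k ∈ Finset.range n,
      γ k • (G (W.edgeSucc (k + 1) ω) (W.reinforcement (k + 1) ω) -
        ∑ e, W.P (k + 1) ω (W.edgeSucc k ω) e • G e (W.reinforcement (k + 1) ω)))
      atTop (𝓝 l) := by
  let 𝒢 : Filtration ℕ mΩ :=
    ⟨fun n => ℱ (n + 1), fun _ _ h => ℱ.mono (Nat.succ_le_succ h), fun n => ℱ.le _⟩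
  set Y : OrientedEdge E → ℕ → Ω → ℝ := fun e k =>
    Set.indicator {ω | (W.X (k + 1) ω, W.X (k + 2) ω) = e.1} (fun _ => (1 : ℝ)) with hYdef
  have hY : ∀ e k, StronglyMeasurable[𝒢 (k + 1)] (Y e k) := by
    intro e k
    refine stronglyMeasurable_const.indicator ?_
    have h1 : MeasurableSet[ℱ (k + 2)] {ω | W.X (k + 1) ω = e.1.1} :=
      ℱ.mono (Nat.le_succ (k + 1)) _ (W.measurable_X (k + 1) e.1.1)
    have h2 : MeasurableSet[ℱ (k + 2)] {ω | W.X (k + 2) ω = e.1.2} := W.measurable_X (k + 2) e.1.2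
    have h3 : {ω | (W.X (k + 1) ω, W.X (k + 2) ω) = e.1} =
        {ω | W.X (k + 1) ω = e.1.1} ∩ {ω | W.X (k + 2) ω = e.1.2} := by
      ext ω
      exact Prod.ext_iff
    rw [h3]
    exact h1.inter h2
  have hscalar : ∀ (e : OrientedEdge E) (r : R), ∀ᵐ ω ∂ℙ, ∃ l, Tendsto
      (fun n => ∑ k ∈ Finset.range n, γ k * G e (W.reinforcement (k + 1) ω) r *
        (Y e k ω - (ℙ[Y e k | ℱ (k + 1)]) ω)) atTop (𝓝 l) := by
    intro e r
    refine ae_exists_tendsto_sum_mul_sub_condExp (𝒢 := 𝒢) (Y := Y e)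
      (a := fun k ω => γ k * G e (W.reinforcement (k + 1) ω) r) (c := fun k => |γ k| * C)
      (fun k => ?_) (fun k ω => ?_) (hY e) (fun k ω => ?_) ?_
    · have h : Continuous fun v => γ k * G e v r := by
        have := hG e
        fun_prop
      exact (h.measurable.comp (W.measurable_reinforcement (k + 1))).stronglyMeasurable
    · rw [abs_mul]
      exact mul_le_mul_of_nonneg_left ((PiLp.norm_apply_le _ r).trans (hC e _)) (abs_nonneg _)
    · by_cases h : ω ∈ {ω | (W.X (k + 1) ω, W.X (k + 2) ω) = e.1}
      · simp only [hYdef, Set.indicator_of_mem h, abs_one, le_refl]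
      · simp only [hYdef, Set.indicator_of_notMem h, abs_zero, zero_le_one]
    · simpa [mul_pow] using hγ.mul_right (C ^ 2)
  filter_upwards [ae_all_iff.2 fun e => ae_all_iff.2 fun r => hscalar e r,
    ae_all_iff.2 fun k => ae_all_iff.2 fun e => W.condLaw k e] with ω hω hlaw
  choose l hl using hω
  refine ⟨WithLp.toLp 2 fun r => ∑ e, l e r, ?_⟩
  have hpi : Tendsto (fun n => fun r => ∑ e, ∑ k ∈ Finset.range n,
      γ k * G e (W.reinforcement (k + 1) ω) r * (Y e k ω - (ℙ[Y e k | ℱ (k + 1)]) ω)) atTop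
      (𝓝 fun r => ∑ e, l e r) :=
    tendsto_pi_nhds.2 fun r => tendsto_finsetSum _ fun e _ => hl e r
  refine (((PiLp.continuous_toLp 2 fun _ : R => ℝ).tendsto _).comp hpi).congr fun n => ?_
  ext r
  have hval : ∀ k e, Y e k ω - (ℙ[Y e k | ℱ (k + 1)]) ω =
      (if W.edgeSucc (k + 1) ω = e then 1 else 0) - W.P (k + 1) ω (W.edgeSucc k ω) e := by
    intro k e
    have h1 : (ℙ[Y e k | ℱ (k + 1)]) ω = W.P (k + 1) ω (W.edgeSucc k ω) e := hlaw k e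
    rw [h1]
    congr 1
    have h2 : W.edgeSucc (k + 1) ω = e ↔ ω ∈ {ω | (W.X (k + 1) ω, W.X (k + 2) ω) = e.1} :=
      Subtype.ext_iff
    by_cases h : W.edgeSucc (k + 1) ω = e
    · rw [if_pos h]
      exact Set.indicator_of_mem (h2.1 h) _
    · rw [if_neg h]
      exact Set.indicator_of_notMem (fun h' => h (h2.2 h')) _
  simp only [Function.comp, hval, PiLp.toLp_apply, WithLp.ofLp_sum, Finset.sum_apply,
    PiLp.smul_apply, PiLp.sub_apply, smul_eq_mul]
  rw [Finset.sum_comm]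
  refine Finset.sum_congr rfl fun k _ => ?_
  simp only [mul_sub, Finset.sum_sub_distrib, mul_ite, mul_one, mul_zero, Finset.sum_ite_eq,
    Finset.mem_univ, if_true, Finset.mul_sum]
  congr 1
  exact Finset.sum_congr rfl fun e _ => by ring

end EdgeWalk

/-! ### The limit set of the reinforcement measures -/

lemma EdgeWalk.reinforcement_succ {Ω : Type*} {mΩ : MeasurableSpace Ω} {ℙ : Measure Ω}
    {ℱ : Filtration ℕ mΩ} {𝒳 : Type*} [Finite 𝒳] {E : Set (Sym2 𝒳)} {R : Type*} [Fintype R]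
    (W : EdgeWalk ℙ ℱ E R) (k : ℕ) (ω : Ω) :
    W.reinforcement (k + 2) ω = W.reinforcement (k + 1) ω +
      ((k : ℝ) + 2 + Fintype.card R)⁻¹ • (W.V (k + 2) ω - W.reinforcement (k + 1) ω) := by
  simp only [EdgeWalk.reinforcement]
  rw [Finset.sum_Icc_succ_top (by omega : 1 ≤ k + 1 + 1)]
  have h1 : (k : ℝ) + 2 + Fintype.card R ≠ 0 := by positivity
  have h2 : (k : ℝ) + 1 + Fintype.card R ≠ 0 := by positivity
  push_cast
  generalize WithLp.toLp 2 (fun _ : R => (1 : ℝ)) = x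
  generalize ∑ i ∈ Finset.Icc 1 (k + 1), W.V i ω = y
  match_scalars <;> field_simp <;> ring

/-- Along an orbit, the total mass `m` satisfies `m' = 1 - m`, and thus stays equal to one. -/
lemma IsFlowOn.massOne_of_univ {R : Type*} [Fintype R]
    {b : EuclideanSpace ℝ R → EuclideanSpace ℝ R} {Φ : ℝ → EuclideanSpace ℝ R → EuclideanSpace ℝ R}
    (hb : ∀ v, b v ∈ massOne R) (hΦ : IsFlowOn Set.univ (fun v => -v + b v) Φ) :
    IsFlowOn (massOne R) (fun v => -v + b v) Φ := by
  refine hΦ.mono (Set.subset_univ _) fun v hv t => ?_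
  have hmass : ∀ s, HasDerivAt (fun s => ∑ r, Φ s v r - 1) (-(∑ r, Φ s v r - 1)) s := by
    intro s
    have h1 : ∀ r, HasDerivAt (fun s => Φ s v r) ((-(Φ s v) + b (Φ s v)) r) s := fun r =>
      (hasDerivAt_pi.1 ((PiLp.hasFDerivAt_ofLp 2 (Φ s v)).comp_hasDerivAt s
        ((hΦ v (Set.mem_univ v)).2 s).2)) r
    refine ((HasDerivAt.fun_sum fun r _ => h1 r).sub_const 1).congr_deriv ?_
    have h2 : ∑ r, b (Φ s v) r = 1 := hb _
    simp [Finset.sum_add_distrib, h2]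
    ring
  have h0 : ∑ r, Φ 0 v r - 1 = 0 := by
    rw [(hΦ v (Set.mem_univ v)).1]
    exact sub_eq_zero.2 hv
  have h := ODE_solution_unique_univ (v := fun _ x : ℝ => -x) (s := fun _ => Set.univ) (K := 1)
    (t₀ := 0) (f := fun s => ∑ r, Φ s v r - 1) (g := fun _ => 0)
    (fun _ => LipschitzWith.id.neg.lipschitzOnWith) (fun s => ⟨hmass s, Set.mem_univ _⟩)
    (fun s => ⟨by simpa using hasDerivAt_const s (0 : ℝ), Set.mem_univ _⟩) h0
  exact sub_eq_zero.1 (congrFun h t)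

theorem theorem3
    {Ω : Type*} {mΩ : MeasurableSpace Ω} (ℙ : Measure Ω) [IsProbabilityMeasure ℙ]
    (ℱ : Filtration ℕ mΩ)
    {𝒳 : Type*} [Finite 𝒳] (E : Set (Sym2 𝒳)) {R : Type*} [Fintype R]
    (W : EdgeWalk ℙ ℱ E R)
    -- first hypotheses
    (V : Matrix (OrientedEdge E) R ℝ) (hV : IsTransitionMatrix V)
    (S : Set (EuclideanSpace ℝ R)) (hS_sub : S ⊆ probMeasures R) (hS_compact : IsCompact S)
    (hS_convex : Convex ℝ S)
    (P : EuclideanSpace ℝ R → Matrix (OrientedEdge E) (OrientedEdge E) ℝ)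
    (hP_markov : ∀ v ∈ S, IsTransitionMatrix (P v)) (hP_cont : ContinuousOn P S)
    (hWV : ∀ᵐ ω ∂ℙ, ∀ n, W.V (n + 1) ω = WithLp.toLp 2 (V (W.edgeSucc n ω)))
    (hWv : ∀ᵐ ω ∂ℙ, ∀ n, 1 ≤ n → W.reinforcement n ω ∈ intrinsicInterior ℝ S)
    (hWP : ∀ᵐ ω ∂ℙ, ∀ n, 1 ≤ n → W.P n ω = P (W.reinforcement n ω))
    -- second hypotheses (the norm of a matrix is the largest absolute value of its entries)
    (hP_lip : ∃ K, ∀ e e', LipschitzOnWith K (fun v => P v e e') S)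
    (hP_ind : ∀ v ∈ intrinsicInterior ℝ S, IsIndecomposable (P v))
    -- third hypotheses, where `g` is the extension of `π^V` to `S`
    (g : EuclideanSpace ℝ R → EuclideanSpace ℝ R)
    (hg_maps : ∀ v ∈ S, g v ∈ probMeasures R)
    (hg_eq : ∀ v ∈ intrinsicInterior ℝ S, g v = piV V (P v))
    (hg_lip : ∃ K, LipschitzOnWith K g S)
    (hQ : ∀ e : OrientedEdge E, ∃ q : EuclideanSpace ℝ R → R → ℝ, ContinuousOn q S ∧
      ∀ v ∈ intrinsicInterior ℝ S, q v = (pseudoInverse (P v) * V) e) :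
    -- `F` induces a unique global flow, for which the limit set is almost surely attractor free
    ∃ Φ : ℝ → EuclideanSpace ℝ R → EuclideanSpace ℝ R,
      IsFlowOn (massOne R) (reinforcementField S g) Φ ∧
      (∀ Ψ, IsFlowOn (massOne R) (reinforcementField S g) Ψ →
        ∀ t, ∀ v ∈ massOne R, Ψ t v = Φ t v) ∧
      ∀ᵐ ω ∂ℙ,
        seqLimitSet (fun n => W.reinforcement n ω) ⊆ S ∧
        IsAttractorFree Φ (seqLimitSet fun n => W.reinforcement n ω) := by
  obtain ⟨ω₀, hω₀⟩ := hWv.exists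
  have hne : S.Nonempty := ⟨_, intrinsicInterior_subset (hω₀ 1 le_rfl)⟩
  have : Nonempty (OrientedEdge E) := ⟨W.edgeSucc 0 ω₀⟩
  have hμS : ∀ v, nearestPoint S v ∈ S := fun v => (nearestPoint_spec hne hS_compact v).1
  have hμ := lipschitzWith_nearestPoint hne hS_compact hS_convex
  have hμc : ∀ {Z : Type _} [TopologicalSpace Z] {f : EuclideanSpace ℝ R → Z},
      ContinuousOn f S → Continuous fun v => f (nearestPoint S v) :=
    fun hf => hf.comp_continuous hμ.continuous hμS
  -- the field and its flow
  obtain ⟨K, hK⟩ := hg_lip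
  have hb : LipschitzWith K fun v => g (nearestPoint S v) := by
    have h := hK.comp hμ.lipschitzOnWith (fun v _ => hμS v) (s := Set.univ)
    rwa [mul_one, lipschitzOnWith_univ] at h
  obtain ⟨B, hB⟩ := hS_compact.exists_bound_of_continuousOn hK.continuousOn
  have hF : LipschitzWith (1 + K) (reinforcementField S g) := LipschitzWith.id.neg.add hb
  obtain ⟨Φ, hΦ⟩ := exists_isFlowOn_univ_neg_add hb fun v => hB _ (hμS v)
  have hΦ1 : IsFlowOn (massOne R) (reinforcementField S g) Φ :=
    hΦ.massOne_of_univ fun v => (hg_maps _ (hμS v)).2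
  change IsFlowOn Set.univ (reinforcementField S g) Φ at hΦ
  refine ⟨Φ, hΦ1, fun Ψ hΨ t v hv => ?_, ?_⟩
  · have h := hΦ.eq_of_hasDerivAt hF (γ := fun s => Ψ s v) (fun s => ((hΨ v hv).2 s).2)
      (Set.mem_univ _) t
    rwa [(hΨ v hv).1] at h
  -- the solutions of the Poisson equation, extended continuously to the whole space
  choose q hqc hq using hQ
  set G : OrientedEdge E → EuclideanSpace ℝ R → EuclideanSpace ℝ R :=
    fun e v => WithLp.toLp 2 (q e (nearestPoint S v)) with hGdef
  have hGc : ∀ e, Continuous (G e) := fun e =>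
    (PiLp.continuous_toLp 2 fun _ : R => ℝ).comp (hμc (hqc e))
  obtain ⟨C, hC⟩ := exists_norm_le_of_continuousOn hS_compact fun e =>
    (PiLp.continuous_toLp 2 fun _ : R => ℝ).comp_continuousOn (hqc e)
  set L : OrientedEdge E → EuclideanSpace ℝ R → EuclideanSpace ℝ R :=
    fun e v => ∑ e', P v e e' • G e' v with hLdef
  have hLc : ∀ e, ContinuousOn (L e) S := fun e => by
    refine continuousOn_finsetSum _ fun e' _ => ContinuousOn.fun_smul ?_ (hGc e').continuousOn
    exact continuousOn_pi.1 (continuousOn_pi.1 hP_cont e) e'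
  have hpoisson : ∀ v ∈ intrinsicInterior ℝ S, ∀ e,
      WithLp.toLp 2 (V e) - g v = G e v - L e v := by
    intro v hv e
    have hvS := intrinsicInterior_subset hv
    ext r
    have h := poisson_equation (hP_markov v hvS) (hP_ind v hv) V e r
    simp only [hLdef, hGdef, hg_eq v hv, nearestPoint_of_mem hS_compact hvS, hq _ v hv]
    simpa using h
  filter_upwards [hWV, hWv, hWP, W.ae_exists_tendsto_sum_fluctuation hGc
    (fun e v => hC e _ (hμS v)) (summable_sq_harmonic_step (Fintype.card R))]
    with ω hV' hv hP' hmart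
  obtain ⟨l, hl⟩ := hmart
  set u : ℕ → EuclideanSpace ℝ R := fun k => W.reinforcement (k + 1) ω with hudef
  have hui : ∀ k, u k ∈ intrinsicInterior ℝ S := fun k => hv (k + 1) (by omega)
  have huS : ∀ k, u k ∈ S := fun k => intrinsicInterior_subset (hui k)
  have hlim : seqLimitSet u = seqLimitSet fun n => W.reinforcement n ω :=
    seqLimitSet_comp_add_one fun n => W.reinforcement n ω
  rw [← hlim]
  refine ⟨seqLimitSet_subset hS_compact.isClosed huS, ?_⟩
  have hγ := antitone_harmonic_step (Fintype.card R)
  have hγ0 := tendsto_harmonic_step (Fintype.card R)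
  have htraj := hΦ.isAsymptoticTrajectory_of_markov_noise hF hγ hγ0 hS_compact huS
    (ξ := fun k => W.edgeSucc k ω) (G := G) (L := L) (fun e => (hGc e).continuousOn) hLc
    (fun k => ?_) (l := l) ?_
  · refine htraj.isAttractorFree hF hΦ (strictMono_nat_of_lt_succ fun n => ?_)
      (tendsto_sum_harmonic_step _) ?_ hS_compact huS
    · rw [Finset.sum_range_succ]
      exact lt_add_of_pos_right _ (by positivity)
    · simpa [Finset.sum_range_succ] using hγ0
  · have h1 := W.reinforcement_succ k ω
    rw [hV' (k + 1)] at h1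
    rw [← hpoisson _ (hui k), reinforcementField, nearestPoint_of_mem hS_compact (huS k)]
    refine h1.trans ?_
    simp only [hudef]
    congr 2
    abel
  · refine hl.congr fun n => Finset.sum_congr rfl fun k _ => ?_
    rw [hP' (k + 1) (by omega)]
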